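/- Let $f:\mathbb{R}^n\to\mathbb{R}$ be twice continuously differentiable, $B\in\mathbb{R}^{p\times n}$, $\lambda_1,\lambda_2>0$, $l\in\mathbb{R}^n_-$, $u\in\mathbb{R}^n_+$, $\Omega=\{x : l\le x\le u\}$, $F(x)=f(x)+\lambda_1\|Bx\|_0+\lambda_2\|x\|_0$ and $g=\lambda_1\|B\cdot\|_0+\lambda_2\|\cdot\|_0+\delta_\Omega$, where $\|\cdot\|_0$ counts nonzero entries and $\delta_C$ is the indicator function of $C$. Let ${\rm prox}_{\gamma g}(z)=\arg\min_x \frac1{2\gamma}\|x-z\|^2+g(x)$ and $\Pi(z)=\{x\in\Omega : {\rm supp}(x)\subset{\rm supp}(z),\ {\rm supp}(Bx)\subset{\rm supp}(Bz)\}$. Fix $\mu_{\max}>\mu_{\min}>0$, $\tau>1$, $\alpha>0$, $b_1>0$, $b_2\ge1$, $\varrho,\sigma\in(0,\frac12)$, $\varsigma\in(\sigma,1]$, $\beta\in(0,1)$. Let $\{x^k\}_{k\in\mathbb{N}}$ be an infinite sequence generated, from some $x^0\in\Omega$, as follows. At step $k$, choose $\mu_k\in[\mu_{\min},\mu_{\max}]$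 and, for $m=0,1,\dots$, pick $\overline{x}^{k}\in{\rm prox}_{(\mu_k\tau^m)^{-1}g}\big(x^k-(\mu_k\tau^m)^{-1}\nabla f(x^k)\big)$, until $F(\overline{x}^k)\le F(x^k)-\frac{\alpha}{2}\|x^k-\overline{x}^k\|^2$ holds, for the first time at $m=m_k$; put $\overline\mu_k=\mu_k\tau^{m_k}$. It is assumed that $x^k\ne\overline{x}^k$ for all $k$ (no termination, with stopping tolerance $0$). * If ${\rm supp}(x^k)={\rm supp}(\overline{x}^k)$ and ${\rm supp}(Bx^k)={\rm supp}(B\overline{x}^k)$ do not both hold, then $x^{k+1}=\overline{x}^k$. * Otherwise put $\rho_k=b_1\|\overline\mu_k(x^k-\overline{x}^k)\|^\sigma$ and let $G_k=\nabla^2f(x^k)+\big(b_2[-\lambda_{\min}(\nabla^2f(x^k))]_++\rho_k\big)I$ or, if $f(x)=h(Ax-b)$ with $h$ separable and twice continuously differentiable (for a representation that does not depend on $k$), alternatively $G_k=\nabla^2f(x^k)+b_2[-\lambda_{\min}(\nabla^2h(Ax^k-b))]_+A^\top A+\rho_kI$ or $G_k=A^\top[\nabla^2h(Ax^k-b)]_+A+\rho_kI$.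 With $\Theta_k(y)=f(x^k)+\langle\nabla f(x^k),y-x^k\rangle+\frac12\langle y-x^k,G_k(y-x^k)\rangle+\delta_{\Pi(x^k)}(y)$, take any $y^k$ such that $\Theta_k(y^k)\le\Theta_k(x^k)$ and $${\rm dist}(0,\partial\Theta_k(y^k))\le\tfrac{\min\{\overline\mu_k^{-1},1\}}{2}\min\big\{\|\overline\mu_k(x^k-\overline{x}^k)\|,\ \|\overline\mu_k(x^k-\overline{x}^k)\|^{1+\varsigma}\big\},$$ put $d^k=y^k-x^k$, let $t_k$ be the smallest integer $t\ge0$ with $f(x^k+\beta^td^k)\le f(x^k)+\varrho\beta^t\langle\nabla f(x^k),d^k\rangle$, and set $x^{k+1}=x^k+\beta^{t_k}d^k$. Let $\Gamma(x^0)$ be the set of accumulation points of $\{x^k\}$, and suppose that $\nabla^2f$ is locally Lipschitz continuous on an open set $\mathcal{O}\supset\Gamma(x^0)$. Then there is $\overline{k}$ such that, for all $k>\overline{k}$, ${\rm supp}(Bx^k)={\rm supp}(B\overline{x}^k)$ and ${\rm supp}(x^k)={\rm supp}(\overline{x}^k)$, and these sets do not depend on $k>\overline{k}$. For any such $\overline{k}$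 put $\Pi_*=\Pi(x^{\overline{k}+1})$. If, moreover, $$0\in\nabla f(x^*)+{\rm ri}\,\mathcal{N}_{\Pi_*}(x^*)\quad\text{for all }x^*\in\Gamma(x^0),$$ then there exist $\mathcal{A}^*\subset[2n]$ and a closed convex cone $\mathcal{N}^*\subset\mathbb{R}^n$ such that, for all sufficiently large $k$, $$\mathcal{A}(x^k)=\mathcal{A}^*\quad\text{and}\quad\mathcal{N}_{\Pi_*}(x^k)=\mathcal{N}^*,$$ where $\mathcal{A}(x)=\{i : x_i=l_i\}\cup\{i+n : x_i=u_i\}$ and $\mathcal{N}_C(x)$ is the normal cone of the convex set $C$ at $x$. -/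

import Mathlib

open Filter Topology
open scoped Pointwise InnerProductSpace Gradient

noncomputable section

namespace PGiPN

/-- `ℝⁿ` with its Euclidean norm and inner product. -/
abbrev Vec (n : ℕ) := EuclideanSpace ℝ (Fin n)

/-! ### Variational notions -/

open Classical in
/-- The indicator function `δ_C`: `0` on `C` and `+∞` off `C`. -/
def indicatorFun {n : ℕ} (C : Set (Vec n)) (x : Vec n) : EReal :=
  if x ∈ C then 0 else ⊤

/-- `prox_{γ h}(z) = argmin_x (1/(2γ)) ‖x - z‖² + h(x)` (a set). -/
def prox {n : ℕ} (γ : ℝ) (h : Vec n → EReal) (z : Vec n) : Set (Vec n) :=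
  {x | ∀ w, ((1 / (2 * γ) * ‖x - z‖ ^ 2 : ℝ) : EReal) + h x
          ≤ ((1 / (2 * γ) * ‖w - z‖ ^ 2 : ℝ) : EReal) + h w}

/-- Regular subgradients: `h x` is finite and `h z ≥ h x + ⟨v, z - x⟩ + o(‖z - x‖)`. -/
def regularSubdiff {n : ℕ} (h : Vec n → EReal) (x : Vec n) : Set (Vec n) :=
  {v | h x ≠ ⊤ ∧ h x ≠ ⊥ ∧ ∀ ε : ℝ, 0 < ε → ∀ᶠ z in 𝓝 x,
      h x + ((⟪v, z - x⟫_ℝ - ε * ‖z - x‖ : ℝ) : EReal) ≤ h z}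

/-- The basic (limiting) subdifferential `∂h(x)`: limits of regular subgradients taken at points
that converge to `x` together with their function values. -/
def limitingSubdiff {n : ℕ} (h : Vec n → EReal) (x : Vec n) : Set (Vec n) :=
  {v | h x ≠ ⊤ ∧ h x ≠ ⊥ ∧ ∃ (xs vs : ℕ → Vec n),
      Tendsto xs atTop (𝓝 x) ∧ Tendsto (fun j => h (xs j)) atTop (𝓝 (h x)) ∧
      (∀ j, vs j ∈ regularSubdiff h (xs j)) ∧ Tendsto vs atTop (𝓝 v)}

/-- The normal cone `N_C(x)` of a convex set `C` (empty if `x ∉ C`). -/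
def normalCone {n : ℕ} (C : Set (Vec n)) (x : Vec n) : Set (Vec n) :=
  {v | x ∈ C ∧ ∀ z ∈ C, ⟪v, z - x⟫_ℝ ≤ 0}

/-- The Hessian `∇²f(x)`, as a linear operator. -/
def hess {n : ℕ} (f : Vec n → ℝ) (x : Vec n) : Vec n →L[ℝ] Vec n :=
  fderiv ℝ (fun y => ∇ f y) x

/-- The smallest eigenvalue of a symmetric matrix or operator. -/
def lambdaMin {R : Type*} [Ring R] [Algebra ℝ R] (a : R) : ℝ := sInf (spectrum ℝ a)

/-! ### The problem `min f(x) + λ₁‖Bx‖₀ + λ₂‖x‖₀` subject to `l ≤ x ≤ u` -/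

/-- The data of the problem. -/
structure Problem (n p : ℕ) where
  f : Vec n → ℝ
  B : Matrix (Fin p) (Fin n) ℝ
  lam₁ : ℝ
  lam₂ : ℝ
  l : Vec n
  u : Vec n
  f_contDiff : ContDiff ℝ 2 f
  lam₁_pos : 0 < lam₁
  lam₂_pos : 0 < lam₂
  l_nonpos : ∀ i, l i ≤ 0
  u_nonneg : ∀ i, 0 ≤ u i

namespace Problem

variable {n p : ℕ} (P : Problem n p)

/-- The box `Ω`. -/
def box : Set (Vec n) := {x | ∀ i, P.l i ≤ x i ∧ x i ≤ P.u i}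

/-- `supp(x)`. -/
def supp (_P : Problem n p) (x : Vec n) : Set (Fin n) := Function.support x.ofLp

/-- `supp(Bx)`. -/
def suppB (x : Vec n) : Set (Fin p) := Function.support (P.B.mulVec x.ofLp)

/-- `λ₁‖Bx‖₀ + λ₂‖x‖₀`. -/
def penalty (x : Vec n) : ℝ :=
  P.lam₁ * ((P.suppB x).ncard : ℝ) + P.lam₂ * ((P.supp x).ncard : ℝ)

/-- `g = λ₁‖B·‖₀ + λ₂‖·‖₀ + δ_Ω`. -/
def g (x : Vec n) : EReal := (P.penalty x : EReal) + indicatorFun P.box x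

/-- The objective `F = f + λ₁‖B·‖₀ + λ₂‖·‖₀`, to be minimized over `Ω`. -/
def F (x : Vec n) : ℝ := P.f x + P.penalty x

/-- `Π(z) = {x ∈ Ω | supp(x) ⊆ supp(z), supp(Bx) ⊆ supp(Bz)}`. -/
def PiSet (z : Vec n) : Set (Vec n) :=
  {x | x ∈ P.box ∧ P.supp x ⊆ P.supp z ∧ P.suppB x ⊆ P.suppB z}

/-- The model `Θ(y) = f(x) + ⟨∇f(x), y - x⟩ + ½⟨y - x, G(y - x)⟩ + δ_{Π(x)}(y)`. -/
def Theta (x : Vec n) (G : Vec n →L[ℝ] Vec n) (y : Vec n) : EReal :=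
  ((P.f x + ⟪∇ P.f x, y - x⟫_ℝ + 1 / 2 * ⟪y - x, G (y - x)⟫_ℝ : ℝ) : EReal)
    + indicatorFun (P.PiSet x) y

/-- The active bound constraints `{i | xᵢ = lᵢ} ∪ {i + n | xᵢ = uᵢ}`, a subset of `[2n]`. -/
def activeSet (x : Vec n) : Set (Fin (n + n)) :=
  Fin.castAdd n '' {i | x i = P.l i} ∪ Fin.natAdd n '' {i | x i = P.u i}

end Problem

/-! ### The algorithm -/

/-- The parameters of the algorithm. -/
structure Params where
  μmin : ℝ
  μmax : ℝ
  τ : ℝ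
  α : ℝ
  b₁ : ℝ
  b₂ : ℝ
  ϱ : ℝ
  σ : ℝ
  ς : ℝ
  β : ℝ
  μmin_pos : 0 < μmin
  μmin_lt_μmax : μmin < μmax
  one_lt_τ : 1 < τ
  α_pos : 0 < α
  b₁_pos : 0 < b₁
  one_le_b₂ : 1 ≤ b₂
  ϱ_mem : ϱ ∈ Set.Ioo (0 : ℝ) (1 / 2)
  σ_mem : σ ∈ Set.Ioo (0 : ℝ) (1 / 2)
  ς_mem : ς ∈ Set.Ioc σ 1
  β_mem : β ∈ Set.Ioo (0 : ℝ) 1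

/-- A representation `f(x) = h(Ax - b)` with `h(z) = ∑ᵢ φᵢ(zᵢ)` separable and twice continuously
differentiable. -/
structure SeparableForm {n : ℕ} (f : Vec n → ℝ) where
  m : ℕ
  A : Matrix (Fin m) (Fin n) ℝ
  b : Fin m → ℝ
  φ : Fin m → ℝ → ℝ
  φ_contDiff : ∀ i, ContDiff ℝ 2 (φ i)
  f_eq : ∀ x, f x = ∑ i, φ i ((A.mulVec x.ofLp - b) i)

namespace SeparableForm

variable {n : ℕ} {f : Vec n → ℝ} (s : SeparableForm f)

/-- The diagonal of `∇²h(Ax - b)`. -/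
def hessDiag (x : Vec n) (i : Fin s.m) : ℝ :=
  deriv (deriv (s.φ i)) ((s.A.mulVec x.ofLp - s.b) i)

/-- `∇²f(x) + b₂ [-λ_min(∇²h(Ax - b))]₊ AᵀA + ρ I`. -/
def hessApprox₁ (b₂ ρ : ℝ) (x : Vec n) : Vec n →L[ℝ] Vec n :=
  hess f x
    + Matrix.toEuclideanCLM (n := Fin n) (𝕜 := ℝ)
        ((b₂ * max (-lambdaMin (Matrix.diagonal (s.hessDiag x))) 0) • (s.A.transpose * s.A))
    + ρ • ContinuousLinearMap.id ℝ (Vec n)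

/-- `Aᵀ [∇²h(Ax - b)]₊ A + ρ I`. -/
def hessApprox₂ (ρ : ℝ) (x : Vec n) : Vec n →L[ℝ] Vec n :=
  Matrix.toEuclideanCLM (n := Fin n) (𝕜 := ℝ)
      (s.A.transpose * Matrix.diagonal (fun i => max (s.hessDiag x i) 0) * s.A)
    + ρ • ContinuousLinearMap.id ℝ (Vec n)

end SeparableForm

/-- `∇²f(x) + (b₂ [-λ_min(∇²f(x))]₊ + ρ) I`. -/
def hessApprox₃ {n : ℕ} (f : Vec n → ℝ) (b₂ ρ : ℝ) (x : Vec n) : Vec n →L[ℝ] Vec n :=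
  hess f x + (b₂ * max (-lambdaMin (hess f x)) 0 + ρ) • ContinuousLinearMap.id ℝ (Vec n)

/-- An infinite run of the hybrid of the proximal gradient method and the inexact projected
regularized Newton method, with stopping tolerance `0`. The sequences are those of the
algorithm: iterates `x k`, proximal points `xbar k`, initial step parameters `μ k`, backtracking
exponents `m k` and `t k`, inexact subproblem solutions `y k`, Hessian approximations `G k`.
The last three matter only at the Newton iterations. -/
structure Run {n p : ℕ} (P : Problem n p) (c : Params) where
  x : ℕ → Vec n
  xbar : ℕ → Vec n
  μ : ℕ → ℝ
  m : ℕ → ℕ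
  y : ℕ → Vec n
  t : ℕ → ℕ
  G : ℕ → (Vec n →L[ℝ] Vec n)
  x_zero_mem : x 0 ∈ P.box
  μ_mem : ∀ k, μ k ∈ Set.Icc c.μmin c.μmax
  /-- `xbar k` is a proximal point for the parameter `μ_k τ ^ m_k` ... -/
  xbar_mem : ∀ k, xbar k ∈
    prox (μ k * c.τ ^ m k)⁻¹ P.g (x k - (μ k * c.τ ^ m k)⁻¹ • ∇ P.f (x k))
  /-- ... that passes the decrease test, ... -/
  xbar_decrease : ∀ k, P.F (xbar k) ≤ P.F (x k) - c.α / 2 * ‖x k - xbar k‖ ^ 2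
  /-- ... and for each smaller exponent the proximal point that was tried failed the test. -/
  backtrack : ∀ k, ∀ j < m k, ∃ z ∈
    prox (μ k * c.τ ^ j)⁻¹ P.g (x k - (μ k * c.τ ^ j)⁻¹ • ∇ P.f (x k)),
      ¬ P.F z ≤ P.F (x k) - c.α / 2 * ‖x k - z‖ ^ 2
  /-- The stopping test with tolerance `0` is never met. -/
  not_stopped : ∀ k, x k ≠ xbar k
  /-- If the switch condition fails, the proximal gradient step is taken. -/
  pg_step : ∀ k, ¬ (P.supp (x k) = P.supp (xbar k) ∧ P.suppB (x k) = P.suppB (xbar k)) →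
    x (k + 1) = xbar k
  /-- If the switch condition holds, `G k` is built by one of the three rules (the first two
  are available when `f` has a separable form, fixed along the run). -/
  G_rule :
    let ρ : ℕ → ℝ := fun k => c.b₁ * ‖(μ k * c.τ ^ m k) • (x k - xbar k)‖ ^ c.σ
    let Switch : ℕ → Prop := fun k =>
      P.supp (x k) = P.supp (xbar k) ∧ P.suppB (x k) = P.suppB (xbar k)
    (∀ k, Switch k → G k = hessApprox₃ P.f c.b₂ (ρ k) (x k)) ∨
    ∃ s : SeparableForm P.f, ∀ k, Switch k →
      G k = s.hessApprox₁ c.b₂ (ρ k) (x k) ∨ G k = s.hessApprox₂ (ρ k) (x k) ∨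
        G k = hessApprox₃ P.f c.b₂ (ρ k) (x k)
  /-- If the switch condition holds, a Newton step is taken: `y k` is an inexact solution of the
  subproblem, `t k` comes from backtracking along `d k = y k - x k`, with step size `β ^ t k`. -/
  newton_step : ∀ k, P.supp (x k) = P.supp (xbar k) ∧ P.suppB (x k) = P.suppB (xbar k) →
    P.Theta (x k) (G k) (y k) ≤ P.Theta (x k) (G k) (x k) ∧
    Metric.infEDist 0 (limitingSubdiff (P.Theta (x k) (G k)) (y k)) ≤
      ENNReal.ofReal (min (μ k * c.τ ^ m k)⁻¹ 1 / 2 *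
        min ‖(μ k * c.τ ^ m k) • (x k - xbar k)‖
          (‖(μ k * c.τ ^ m k) • (x k - xbar k)‖ ^ (1 + c.ς))) ∧
    IsLeast {t : ℕ | P.f (x k + c.β ^ t • (y k - x k)) ≤
      P.f (x k) + c.ϱ * c.β ^ t * ⟪∇ P.f (x k), y k - x k⟫_ℝ} (t k) ∧
    x (k + 1) = x k + c.β ^ t k • (y k - x k)

namespace Run

variable {n p : ℕ} {P : Problem n p} {c : Params} (R : Run P c)

/-- The set `Γ(x⁰)` of accumulation points of the iterates. -/
def accPts : Set (Vec n) := {z | MapClusterPt z atTop R.x}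

/-- After the index `kbar` the supports of `x k`, `xbar k` are one fixed set `S`, and those of
`B (x k)`, `B (xbar k)` are one fixed set `T`. -/
def SupportsStableAfter (kbar : ℕ) : Prop :=
  ∃ (T : Set (Fin p)) (S : Set (Fin n)), ∀ k, kbar < k →
    P.suppB (R.x k) = T ∧ P.suppB (R.xbar k) = T ∧
    P.supp (R.x k) = S ∧ P.supp (R.xbar k) = S

end Run

end PGiPN

end

noncomputable section

namespace PGiPN

namespace Problem

variable {n p : ℕ} (P : Problem n p)

/-! ### The feasible sets and the penalty -/

/-! Write `r_k = ‖μ̄_k (x^k - x̄^k)‖` and `d^k = y^k - x^k`. Every step lowers `F` by at least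
`ψ(r_k)`, with `ψ` positive and nondecreasing on positive reals (`exists_decrease`). At a Newton
step this rests on `r_k = O(‖d^k‖)`, obtained by testing the normals at `y^k` and at `x̄^k` against
each other (`exists_newton_bounds`), and on Armijo steps at least `min 1 (κ ρ_k)`
(`exists_le_beta_pow`). As `F` is bounded below on the compact box, `r_k → 0`. Since also `ρ_k ‖d^k‖
= O(r_k)` with `ρ_k = b₁ r_k ^ σ` and `σ < 1`, the Newton directions vanish as well.

The penalty takes discrete values, so a proximal point cannot keep a larger support than its limit
point without losing optimality (`eventually_supp_xbar_subset`). Because consecutive points merge,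
all supports freeze; from then on only Newton steps occur, on one fixed polyhedron `Π_*`.

The subproblem residuals supply normals `v_k` to `Π_*` at `y^k` with `v_k + ∇f(x^k) → 0`. At a limit
point `a`, the vector `-∇f(a)` is a relatively interior normal, which forces `y^k` to acquire
exactly the active bounds of `a` (`eventually_activeSet_eq`). As `y^{k+1} - y^k → 0`, the active set
of `y^k` is eventually constant, and the line search carries this over to `x^k`. On `Π_*` the normal
cone depends only on the active bounds (`normalCone_PiSet_mono`), so it is eventually constant too.
-/

lemma isCompact_box : IsCompact P.box := by
  have h : P.box = (WithLp.toLp 2) '' (Set.Icc P.l.ofLp P.u.ofLp) := by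
    ext x
    constructor
    · intro hx
      exact ⟨x.ofLp, ⟨fun i => (hx i).1, fun i => (hx i).2⟩, rfl⟩
    · rintro ⟨y, hy, rfl⟩ i
      exact ⟨hy.1 i, hy.2 i⟩
  rw [h]
  exact isCompact_Icc.image (PiLp.continuous_toLp 2 _)

lemma zero_mem_box : (0 : Vec n) ∈ P.box := fun i => ⟨P.l_nonpos i, P.u_nonneg i⟩

lemma convex_box : Convex ℝ P.box := by
  intro x hx y hy a b ha hb hab i
  have hx' := hx i
  have hy' := hy i
  simp only [PiLp.add_apply, PiLp.smul_apply, smul_eq_mul]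
  have h1 : P.l i = a * P.l i + b * P.l i := by rw [← add_mul, hab, one_mul]
  have h2 : P.u i = a * P.u i + b * P.u i := by rw [← add_mul, hab, one_mul]
  rw [h1, h2]
  exact ⟨by gcongr; exacts [hx'.1, hy'.1], by gcongr; exacts [hx'.2, hy'.2]⟩

lemma mem_PiSet_iff {z x : Vec n} : x ∈ P.PiSet z ↔ x ∈ P.box ∧
    (∀ i, z i = 0 → x i = 0) ∧
      ∀ j, P.B.mulVec z.ofLp j = 0 → P.B.mulVec x.ofLp j = 0 := by
  simp only [PiSet, supp, suppB, Set.mem_ofPred_eq, Function.support_subset_iff',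
    Function.notMem_support]

/-- Affine combinations that stay in the box stay in `Π(z)`. -/
lemma add_smul_sub_mem_PiSet {z x y w : Vec n} (hx : x ∈ P.PiSet z) (hy : y ∈ P.PiSet z)
    (hw : w ∈ P.PiSet z) {s : ℝ} (hbox : x + s • (y - w) ∈ P.box) :
    x + s • (y - w) ∈ P.PiSet z := by
  rw [mem_PiSet_iff] at *
  refine ⟨hbox, fun i hi => ?_, fun j hj => ?_⟩
  · simp [hx.2.1 i hi, hy.2.1 i hi, hw.2.1 i hi]
  · simp [Matrix.mulVec_add, Matrix.mulVec_smul, Matrix.mulVec_sub, hx.2.2 j hj, hy.2.2 j hj,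
      hw.2.2 j hj]

lemma convex_PiSet (z : Vec n) : Convex ℝ (P.PiSet z) := by
  rw [convex_iff_add_mem]
  intro x hx y hy a b ha hb hab
  have h : a • x + b • y = x + b • (y - x) := by
    rw [← eq_sub_iff_add_eq] at hab
    rw [hab]; module
  have := P.convex_box hx.1 hy.1 ha hb hab
  rw [h] at this ⊢
  exact P.add_smul_sub_mem_PiSet hx hy hx this

lemma isClosed_box : IsClosed P.box := P.isCompact_box.isClosed

lemma self_mem_PiSet {z : Vec n} (hz : z ∈ P.box) : z ∈ P.PiSet z := ⟨hz, le_rfl, le_rfl⟩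

lemma continuous_mulVec (j : Fin p) : Continuous fun x : Vec n => P.B.mulVec x.ofLp j := by
  unfold Matrix.mulVec dotProduct
  fun_prop

lemma isClosed_PiSet (z : Vec n) : IsClosed (P.PiSet z) := by
  have h : P.PiSet z = P.box ∩ ((⋂ i, ⋂ (_ : z i = 0), {x | x i = 0}) ∩
      ⋂ j, ⋂ (_ : P.B.mulVec z.ofLp j = 0), {x | P.B.mulVec x.ofLp j = 0}) := by
    ext x; simp [mem_PiSet_iff]
  rw [h]
  refine P.isClosed_box.inter (IsClosed.inter ?_ ?_)
  · exact isClosed_iInter fun i => isClosed_iInter fun _ =>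
      isClosed_eq (by fun_prop) continuous_const
  · exact isClosed_iInter fun j => isClosed_iInter fun _ =>
      isClosed_eq (P.continuous_mulVec j) continuous_const

lemma penalty_mono {x y : Vec n} (h : P.supp x ⊆ P.supp y) (hB : P.suppB x ⊆ P.suppB y) :
    P.penalty x ≤ P.penalty y := by
  unfold penalty
  have h1 := Set.ncard_le_ncard h (Set.toFinite _)
  have h2 := Set.ncard_le_ncard hB (Set.toFinite _)
  have := P.lam₁_pos
  have := P.lam₂_pos
  gcongr

lemma penalty_nonneg (x : Vec n) : 0 ≤ P.penalty x := by
  have := P.lam₁_pos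
  have := P.lam₂_pos
  unfold penalty
  positivity

/-- The penalty jumps by at least `min λ₁ λ₂` when a support grows strictly. -/
lemma supp_eq_of_penalty_lt {x y : Vec n} (h : P.supp x ⊆ P.supp y)
    (hB : P.suppB x ⊆ P.suppB y) (hlt : P.penalty y < P.penalty x + min P.lam₁ P.lam₂) :
    P.supp x = P.supp y ∧ P.suppB x = P.suppB y := by
  have h1 := Set.ncard_le_ncard h (Set.toFinite _)
  have h2 := Set.ncard_le_ncard hB (Set.toFinite _)
  have p1 := P.lam₁_pos
  have p2 := P.lam₂_pos
  have m1 := min_le_left P.lam₁ P.lam₂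
  have m2 := min_le_right P.lam₁ P.lam₂
  have h1r : ((P.supp x).ncard : ℝ) ≤ (P.supp y).ncard := by exact_mod_cast h1
  have h2r : ((P.suppB x).ncard : ℝ) ≤ (P.suppB y).ncard := by exact_mod_cast h2
  unfold penalty at hlt
  constructor
  · refine Set.eq_of_subset_of_ncard_le h ?_ (Set.toFinite _)
    by_contra! hc
    have : ((P.supp x).ncard : ℝ) + 1 ≤ (P.supp y).ncard := by exact_mod_cast hc
    nlinarith
  · refine Set.eq_of_subset_of_ncard_le hB ?_ (Set.toFinite _)
    by_contra! hc
    have : ((P.suppB x).ncard : ℝ) + 1 ≤ (P.suppB y).ncard := by exact_mod_cast hc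
    nlinarith

/-- Supports are lower semicontinuous. -/
lemma eventually_supp_subset (x : Vec n) :
    ∀ᶠ y in 𝓝 x, P.supp x ⊆ P.supp y ∧ P.suppB x ⊆ P.suppB y := by
  have h1 : ∀ᶠ y in 𝓝 x, ∀ i, x i ≠ 0 → y i ≠ 0 := by
    rw [eventually_all]
    intro i
    by_cases hi : x i = 0
    · simp [hi]
    · have : ContinuousAt (fun y : Vec n => y i) x := by fun_prop
      filter_upwards [this.eventually_ne hi] with y hy _ using hy
  have h2 : ∀ᶠ y : Vec n in 𝓝 x, ∀ j, P.B.mulVec x.ofLp j ≠ 0 → P.B.mulVec y.ofLp j ≠ 0 := by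
    rw [eventually_all]
    intro i
    by_cases hi : P.B.mulVec x.ofLp i = 0
    · simp [hi]
    · filter_upwards [(P.continuous_mulVec i).continuousAt.eventually_ne hi] with y hy _ using hy
  filter_upwards [h1, h2] with y hy1 hy2
  exact ⟨fun i hi => hy1 i hi, fun j hj => hy2 j hj⟩

/-! ### Proximal points -/

lemma mem_prox_iff {γ : ℝ} {z x : Vec n} : x ∈ prox γ P.g z ↔ x ∈ P.box ∧
    ∀ w ∈ P.box, 1 / (2 * γ) * ‖x - z‖ ^ 2 + P.penalty x ≤
      1 / (2 * γ) * ‖w - z‖ ^ 2 + P.penalty w := by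
  have hin : ∀ w ∈ P.box, ((1 / (2 * γ) * ‖w - z‖ ^ 2 : ℝ) : EReal) + P.g w =
      ((1 / (2 * γ) * ‖w - z‖ ^ 2 + P.penalty w : ℝ) : EReal) := by
    intro w hw
    simp [g, indicatorFun, hw]
  have hout : ∀ w ∉ P.box, ((1 / (2 * γ) * ‖w - z‖ ^ 2 : ℝ) : EReal) + P.g w = ⊤ := by
    intro w hw
    simp only [g, indicatorFun, hw, if_false, EReal.coe_add_top]
  constructor
  · intro h
    have hx : x ∈ P.box := by
      by_contra hx
      -- The origin is a feasible competitor of finite value, because `l ≤ 0 ≤ u`.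
      have := h 0
      rw [hout x hx, hin 0 P.zero_mem_box] at this
      exact EReal.coe_ne_top _ (top_le_iff.1 this)
    refine ⟨hx, fun w hw => ?_⟩
    have := h w
    rw [hin x hx, hin w hw] at this
    exact_mod_cast this
  · rintro ⟨hx, h⟩ w
    by_cases hw : w ∈ P.box
    · rw [hin x hx, hin w hw]
      exact_mod_cast h w hw
    · rw [hout w hw]
      exact le_top

/-- Optimality of a proximal gradient step with parameter `μ`. -/
lemma prox_grad_le {μ : ℝ} (hμ : 0 < μ) {x v z : Vec n}
    (hz : z ∈ prox μ⁻¹ P.g (x - μ⁻¹ • v)) {w : Vec n} (hw : w ∈ P.box) :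
    μ / 2 * ‖z - x‖ ^ 2 + ⟪v, z - x⟫_ℝ + P.penalty z ≤
      μ / 2 * ‖w - x‖ ^ 2 + ⟪v, w - x⟫_ℝ + P.penalty w := by
  have h := (P.mem_prox_iff.1 hz).2 w hw
  -- Completing the square: the proximal objective is the linearized model up to a constant
  -- independent of `y`.
  have key : ∀ y : Vec n, 1 / (2 * μ⁻¹) * ‖y - (x - μ⁻¹ • v)‖ ^ 2 =
      μ / 2 * ‖y - x‖ ^ 2 + ⟪v, y - x⟫_ℝ + 1 / (2 * μ) * ‖v‖ ^ 2 := by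
    intro y
    rw [show y - (x - μ⁻¹ • v) = (y - x) + μ⁻¹ • v by module, norm_add_sq_real,
      real_inner_smul_right, norm_smul, Real.norm_eq_abs, abs_of_pos (inv_pos.2 hμ),
      real_inner_comm]
    field_simp
  rw [key, key] at h
  linarith

lemma prox_grad_mem_box {γ : ℝ} {x z : Vec n} (hz : z ∈ prox γ P.g x) : z ∈ P.box :=
  (P.mem_prox_iff.1 hz).1

/-! ### Normal cones -/

/-- When the supports agree, no point of `Π(x)` has a larger penalty than `z`. Hence `z` minimizes
the smooth quadratic model over the convex set `Π(x)`, and this is its first-order condition,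
obtained along segments from `z`. -/
lemma mem_normalCone_prox_grad {μ : ℝ} (hμ : 0 < μ) {x v z : Vec n}
    (hz : z ∈ prox μ⁻¹ P.g (x - μ⁻¹ • v))
    (hs : P.supp x = P.supp z) (hB : P.suppB x = P.suppB z) :
    μ • (x - z) - v ∈ normalCone (P.PiSet x) z := by
  have hzP : z ∈ P.PiSet x := ⟨P.prox_grad_mem_box hz, hs.ge, hB.ge⟩
  refine ⟨hzP, fun w hw => ?_⟩
  have key : ∀ s ∈ Set.Ioc (0 : ℝ) 1,
      ⟪μ • (x - z) - v, w - z⟫_ℝ ≤ s * (μ / 2 * ‖w - z‖ ^ 2) := by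
    intro s hs01
    have hmem : z + s • (w - z) ∈ P.PiSet x :=
      (P.convex_PiSet x).add_smul_sub_mem hzP hw ⟨hs01.1.le, hs01.2⟩
    have h1 := P.prox_grad_le hμ hz hmem.1
    have h2 : P.penalty (z + s • (w - z)) ≤ P.penalty z :=
      P.penalty_mono (hmem.2.1.trans hs.le) (hmem.2.2.trans hB.le)
    rw [show z + s • (w - z) - x = (z - x) + s • (w - z) by module, norm_add_sq_real,
      inner_add_right, real_inner_smul_right, real_inner_smul_right, norm_smul,
      Real.norm_eq_abs, mul_pow, sq_abs] at h1
    rw [inner_sub_left, real_inner_smul_left, ← neg_sub z x, inner_neg_left]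
    have h3 : 0 ≤ s * (s * (μ / 2 * ‖w - z‖ ^ 2)
        - (μ * -⟪z - x, w - z⟫_ℝ - ⟪v, w - z⟫_ℝ)) := by nlinarith
    have := (mul_nonneg_iff_of_pos_left hs01.1).1 h3
    linarith
  have hlim : Tendsto (fun s : ℝ => s * (μ / 2 * ‖w - z‖ ^ 2)) (𝓝[>] 0) (𝓝 0) := by
    have : Tendsto (fun s : ℝ => s * (μ / 2 * ‖w - z‖ ^ 2)) (𝓝 0) (𝓝 (0 * _)) :=
      (continuous_id.mul continuous_const).tendsto 0
    rw [zero_mul] at this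
    exact this.mono_left nhdsWithin_le_nhds
  refine ge_of_tendsto hlim ?_
  filter_upwards [Ioc_mem_nhdsGT (zero_lt_one' ℝ)] with s hs01 using key s hs01

lemma castAdd_mem_activeSet {x : Vec n} {i : Fin n} :
    Fin.castAdd n i ∈ P.activeSet x ↔ x i = P.l i := by
  simp only [activeSet, Set.mem_union, Set.mem_image, Set.mem_ofPred_eq]
  constructor
  · rintro (⟨j, hj, hji⟩ | ⟨j, hj, hji⟩)
    · rwa [← Fin.castAdd_injective n n hji]
    · have := congrArg Fin.val hji
      simp at this
      omega
  · exact fun h => Or.inl ⟨i, h, rfl⟩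

lemma natAdd_mem_activeSet {x : Vec n} {i : Fin n} :
    Fin.natAdd n i ∈ P.activeSet x ↔ x i = P.u i := by
  simp only [activeSet, Set.mem_union, Set.mem_image, Set.mem_ofPred_eq]
  constructor
  · rintro (⟨j, hj, hji⟩ | ⟨j, hj, hji⟩)
    · have := congrArg Fin.val hji
      simp at this
      omega
    · rwa [← Fin.natAdd_injective n n hji]
  · exact fun h => Or.inr ⟨i, h, rfl⟩

lemma activeSet_subset_iff {x y : Vec n} : P.activeSet x ⊆ P.activeSet y ↔
    (∀ i, x i = P.l i → y i = P.l i) ∧ ∀ i, x i = P.u i → y i = P.u i := by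
  constructor
  · intro h
    exact ⟨fun i hi => P.castAdd_mem_activeSet.1 (h (P.castAdd_mem_activeSet.2 hi)),
      fun i hi => P.natAdd_mem_activeSet.1 (h (P.natAdd_mem_activeSet.2 hi))⟩
  · rintro ⟨h1, h2⟩ a (⟨i, hi, rfl⟩ | ⟨i, hi, rfl⟩)
    · exact P.castAdd_mem_activeSet.2 (h1 i hi)
    · exact P.natAdd_mem_activeSet.2 (h2 i hi)

lemma eventually_activeSet_subset (x : Vec n) :
    ∀ᶠ y in 𝓝 x, P.activeSet y ⊆ P.activeSet x := by
  have hc : ∀ i, ContinuousAt (fun y : Vec n => y i) x := fun i => by fun_prop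
  have h1 : ∀ᶠ y in 𝓝 x, ∀ i, y i = P.l i → x i = P.l i := by
    rw [eventually_all]
    intro i
    by_cases hi : x i = P.l i
    · simp [hi]
    · filter_upwards [(hc i).eventually_ne hi] with y hy h using absurd h hy
  have h2 : ∀ᶠ y in 𝓝 x, ∀ i, y i = P.u i → x i = P.u i := by
    rw [eventually_all]
    intro i
    by_cases hi : x i = P.u i
    · simp [hi]
    · filter_upwards [(hc i).eventually_ne hi] with y hy h using absurd h hy
  filter_upwards [h1, h2] with y hy1 hy2
  exact P.activeSet_subset_iff.2 ⟨hy1, hy2⟩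

/-- On a convex combination with weight in `(0, 1)`, exactly the constraints that are active at
both ends are active. -/
lemma activeSet_add_smul {x y : Vec n} (hx : x ∈ P.box) (hy : y ∈ P.box) {s : ℝ}
    (h0 : 0 < s) (h1 : s < 1) :
    P.activeSet (x + s • (y - x)) = P.activeSet x ∩ P.activeSet y := by
  have hv : ∀ i, (x + s • (y - x)) i = x i + s * (y i - x i) := fun i => by simp
  ext a
  refine Fin.addCases (fun i => ?_) (fun i => ?_) a
  · rw [Set.mem_inter_iff]
    simp only [castAdd_mem_activeSet, hv]
    have hx' := (hx i).1
    have hy' := (hy i).1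
    refine ⟨fun h => ?_, fun ⟨h, h'⟩ => by rw [h, h']; ring⟩
    constructor <;> nlinarith [mul_nonneg h0.le (sub_nonneg.2 hy'),
      mul_nonneg (sub_nonneg.2 h1.le) (sub_nonneg.2 hx'), mul_pos h0 (sub_pos.2 h1)]
  · rw [Set.mem_inter_iff]
    simp only [natAdd_mem_activeSet, hv]
    have hx' := (hx i).2
    have hy' := (hy i).2
    refine ⟨fun h => ?_, fun ⟨h, h'⟩ => by rw [h, h']; ring⟩
    constructor <;> nlinarith [mul_nonneg h0.le (sub_nonneg.2 hy'),
      mul_nonneg (sub_nonneg.2 h1.le) (sub_nonneg.2 hx'), mul_pos h0 (sub_pos.2 h1)]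

/-- The normal cone of `Π(z)` at a point shrinks with the set of active bounds. -/
lemma normalCone_PiSet_mono {z x y : Vec n} (hx : x ∈ P.PiSet z) (hy : y ∈ P.PiSet z)
    (hA : P.activeSet x ⊆ P.activeSet y) :
    normalCone (P.PiSet z) x ⊆ normalCone (P.PiSet z) y := by
  rintro v ⟨-, hv⟩
  refine ⟨hy, fun w hw => ?_⟩
  rw [activeSet_subset_iff] at hA
  -- A bound active at `x` is active at `y`, so `w - y` points inward there; every other bound has
  -- slack at `x`. The normal inequality at `x` can therefore be tested in the direction `w - y`.
  have hbox : ∀ᶠ s : ℝ in 𝓝[>] 0, x + s • (w - y) ∈ P.box := by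
    have hcont : ∀ i, Tendsto (fun s : ℝ => x i + s * (w i - y i)) (𝓝[>] 0) (𝓝 (x i)) := by
      intro i
      have : Tendsto (fun s : ℝ => x i + s * (w i - y i)) (𝓝 0) (𝓝 (x i + 0 * (w i - y i))) :=
        Continuous.tendsto (by fun_prop) 0
      rw [zero_mul, add_zero] at this
      exact this.mono_left nhdsWithin_le_nhds
    have : ∀ᶠ s : ℝ in 𝓝[>] 0, ∀ i, P.l i ≤ x i + s * (w i - y i) ∧
        x i + s * (w i - y i) ≤ P.u i := by
      rw [eventually_all]
      intro i
      rw [eventually_and]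
      constructor
      · rcases (hx.1 i).1.eq_or_lt with h | h
        · filter_upwards [self_mem_nhdsWithin] with s hs
          rw [hA.1 i h.symm, ← h]
          have : 0 ≤ s * (w i - P.l i) := mul_nonneg (le_of_lt hs) (sub_nonneg.2 (hw.1 i).1)
          linarith
        · filter_upwards [(hcont i).eventually_const_lt h] with s hs using hs.le
      · rcases (hx.1 i).2.eq_or_lt with h | h
        · filter_upwards [self_mem_nhdsWithin] with s hs
          rw [hA.2 i h, h]
          have : 0 ≤ s * (P.u i - w i) := mul_nonneg (le_of_lt hs) (sub_nonneg.2 (hw.1 i).2)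
          linarith
        · filter_upwards [(hcont i).eventually_lt_const h] with s hs using hs.le
    filter_upwards [this] with s hs i
    simpa using hs i
  obtain ⟨s, hs, hs0⟩ := (hbox.and self_mem_nhdsWithin).exists
  have := hv _ (P.add_smul_sub_mem_PiSet hx hw hy hs)
  rw [add_sub_cancel_left, real_inner_smul_right] at this
  exact nonpos_of_mul_nonpos_right this hs0

end Problem

/-- At a point of the set, the normal cone is a closed convex cone. -/
lemma exists_properCone_eq_normalCone {n : ℕ} {C : Set (Vec n)} {x : Vec n} (hx : x ∈ C) :
    ∃ N : ProperCone ℝ (Vec n), normalCone C x = (N : Set (Vec n)) := by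
  refine ⟨ProperCone.innerDual ((fun z => x - z) '' C), ?_⟩
  ext v
  simp only [normalCone, Set.mem_ofPred_eq, SetLike.mem_coe, ProperCone.mem_innerDual]
  constructor
  · rintro ⟨-, h⟩ _ ⟨z, hz, rfl⟩
    have := h z hz
    rw [← neg_sub x z, inner_neg_right] at this
    rw [real_inner_comm]
    linarith
  · intro h
    refine ⟨hx, fun z hz => ?_⟩
    have := h ⟨z, hz, rfl⟩
    rw [real_inner_comm] at this
    rw [← neg_sub x z, inner_neg_right]
    linarith

/-! ### First and second derivatives -/

section Smooth

variable {n : ℕ} {f : Vec n → ℝ}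

lemma contDiff_gradient (hf : ContDiff ℝ 2 f) : ContDiff ℝ 1 fun y => ∇ f y := by
  have h : ContDiff ℝ 1 (fderiv ℝ f) := hf.fderiv_right (by norm_num)
  exact (InnerProductSpace.toDual ℝ (Vec n)).symm.contDiff.comp h

lemma continuous_gradient (hf : ContDiff ℝ 2 f) : Continuous fun y => ∇ f y :=
  (contDiff_gradient hf).continuous

lemma continuous_hess (hf : ContDiff ℝ 2 f) : Continuous (hess f) :=
  (contDiff_gradient hf).continuous_fderiv one_ne_zero

/-- Differentiating `y ↦ ⟪∇ f y, w⟫ = f'(y) w` in two ways identifies the Hessian operator with the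
second derivative, whose symmetry then transfers. -/
lemma inner_hess (hf : ContDiff ℝ 2 f) (x u w : Vec n) :
    ⟪hess f x u, w⟫_ℝ = fderiv ℝ (fderiv ℝ f) x u w := by
  have h : ContDiff ℝ 1 (fderiv ℝ f) := hf.fderiv_right (by norm_num)
  have h1 : HasFDerivAt (fun y => ⟪∇ f y, w⟫_ℝ)
      ((fderivInnerCLM ℝ (∇ f x, w)).comp ((hess f x).prod 0)) x :=
    ((contDiff_gradient hf).differentiable one_ne_zero x).hasFDerivAt.inner ℝ
      (hasFDerivAt_const w x)
  have h2 : HasFDerivAt (fun y => ⟪∇ f y, w⟫_ℝ) ((fderiv ℝ (fderiv ℝ f) x).flip w) x := by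
    have h3 := ((h.differentiable one_ne_zero) x).hasFDerivAt.clm_apply (hasFDerivAt_const w x)
    simpa [inner_gradient_left] using h3
  have h3 := congrArg (fun T : Vec n →L[ℝ] ℝ => T u) (h1.unique h2)
  simpa [fderivInnerCLM_apply] using h3

lemma inner_hess_comm (hf : ContDiff ℝ 2 f) (x u w : Vec n) :
    ⟪hess f x u, w⟫_ℝ = ⟪u, hess f x w⟫_ℝ := by
  rw [inner_hess hf, real_inner_comm, inner_hess hf]
  exact (hf.contDiffAt.isSymmSndFDerivAt (by simp)) u w

/-- A quadratic upper bound for `f` on a convex set with a bounded Hessian. -/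
lemma le_add_inner_gradient_add_sq (hf : ContDiff ℝ 2 f) {s : Set (Vec n)} (hs : Convex ℝ s)
    {L : ℝ} (hL : ∀ x ∈ s, ‖hess f x‖ ≤ L) {x y : Vec n} (hx : x ∈ s) (hy : y ∈ s) :
    f y ≤ f x + ⟪∇ f x, y - x⟫_ℝ + L * ‖y - x‖ ^ 2 := by
  have hL0 : 0 ≤ L := (norm_nonneg _).trans (hL x hx)
  have hgrad : ∀ z ∈ s, ‖∇ f z - ∇ f x‖ ≤ L * ‖z - x‖ := fun z hz =>
    hs.norm_image_sub_le_of_norm_fderiv_le (𝕜 := ℝ) (f := fun y => ∇ f y)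
      (fun w _ => (contDiff_gradient hf).differentiable one_ne_zero w) hL hx hz
  have hsub : segment ℝ x y ⊆ s := hs.segment_subset hx hy
  have hbound : ∀ z ∈ segment ℝ x y, ‖fderiv ℝ f z - fderiv ℝ f x‖ ≤ L * ‖y - x‖ := by
    intro z hz
    have h1 : ‖fderiv ℝ f z - fderiv ℝ f x‖ = ‖∇ f z - ∇ f x‖ := by
      rw [← toDual_gradient, ← toDual_gradient, ← map_sub, LinearIsometryEquiv.norm_map]
    rw [h1]
    refine (hgrad z (hsub hz)).trans ?_
    have h2 : ‖z - x‖ ≤ ‖y - x‖ := by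
      rw [segment_eq_image'] at hz
      obtain ⟨t, ht, rfl⟩ := hz
      simp only [add_sub_cancel_left, norm_smul, Real.norm_eq_abs, abs_of_nonneg ht.1]
      exact mul_le_of_le_one_left (norm_nonneg _) ht.2
    gcongr
  -- Mean value inequality for `f - f'(x)` on the segment. It uses one uniform bound on the
  -- derivative difference, hence the constant `L` instead of `L / 2`.
  have h := (convex_segment x y).norm_image_sub_le_of_norm_hasFDerivWithin_le'
    (fun z _ => ((hf.differentiable two_ne_zero) z).hasFDerivAt.hasFDerivWithinAt) hbound
    (left_mem_segment ℝ x y) (right_mem_segment ℝ x y)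
  rw [← inner_gradient_left] at h
  have := (Real.norm_eq_abs _ ▸ le_abs_self _).trans h
  nlinarith

end Smooth

/-! ### The smallest eigenvalue -/

section LambdaMin

variable {n : ℕ}

lemma neg_lambdaMin_le_norm (H : Vec n →L[ℝ] Vec n) : -lambdaMin H ≤ ‖H‖ := by
  unfold lambdaMin
  rcases (spectrum ℝ H).eq_empty_or_nonempty with h | h
  -- The infimum of the empty set is `0` by convention, so the bound is trivial.
  · simp [h]
  · rw [neg_le]
    refine le_csInf h fun k hk => ?_
    have h1 := spectrum.norm_le_norm_mul_of_mem hk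
    have h2 : ‖(1 : Vec n →L[ℝ] Vec n)‖ ≤ 1 := ContinuousLinearMap.norm_id_le
    have h3 : ‖k‖ ≤ ‖H‖ := h1.trans (mul_le_of_le_one_right (norm_nonneg _) h2)
    exact neg_le_of_abs_le h3

/-- For a symmetric operator the infimum `q` of the Rayleigh quotient is an eigenvalue, so
`lambdaMin H ≤ q`, and `q` is at most the quotient at `v`. -/
lemma lambdaMin_mul_sq_le (H : Vec n →L[ℝ] Vec n) (hH : ∀ u w, ⟪H u, w⟫_ℝ = ⟪u, H w⟫_ℝ)
    (v : Vec n) : lambdaMin H * ‖v‖ ^ 2 ≤ ⟪v, H v⟫_ℝ := by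
  rcases eq_or_ne v 0 with rfl | hv
  · simp
  have : Nontrivial (Vec n) := ⟨⟨v, 0, hv⟩⟩
  have hsym : (H : Vec n →ₗ[ℝ] Vec n).IsSymmetric := hH
  have hev := hsym.hasEigenvalue_iInf_of_finiteDimensional
  set q := ⨅ x : {x : Vec n // x ≠ 0}, RCLike.re ⟪(H : Vec n →ₗ[ℝ] Vec n) x, (x : Vec n)⟫_ℝ /
    ‖(x : Vec n)‖ ^ 2 with hq
  obtain ⟨e, he⟩ := hev.exists_hasEigenvector
  have hHe : H e = q • e := he.apply_eq_smul
  have hmem : q ∈ spectrum ℝ H := by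
    rw [spectrum.mem_iff]
    rintro ⟨U, hU⟩
    have h0 : (U : Vec n →L[ℝ] Vec n) e = 0 := by
      rw [hU, Algebra.algebraMap_eq_smul_one]
      simp [hHe]
    apply he.2
    calc e = ((↑U⁻¹ : Vec n →L[ℝ] Vec n) * U) e := by rw [U.inv_mul]; rfl
      _ = (↑U⁻¹ : Vec n →L[ℝ] Vec n) ((U : Vec n →L[ℝ] Vec n) e) := rfl
      _ = 0 := by rw [h0, map_zero]
  have hlow : ∀ k ∈ spectrum ℝ H, -‖H‖ * ‖(1 : Vec n →L[ℝ] Vec n)‖ ≤ k := fun k hk => by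
    have h1 := spectrum.norm_le_norm_mul_of_mem hk
    rw [neg_mul]
    exact neg_le_of_abs_le h1
  have h1 : lambdaMin H ≤ q := csInf_le ⟨_, hlow⟩ hmem
  have hv2 : 0 < ‖v‖ ^ 2 := by positivity
  have hbdd : BddBelow (Set.range fun x : {x : Vec n // x ≠ 0} =>
      RCLike.re ⟪(H : Vec n →ₗ[ℝ] Vec n) x, (x : Vec n)⟫_ℝ / ‖(x : Vec n)‖ ^ 2) := by
    refine ⟨-‖H‖, ?_⟩
    rintro _ ⟨⟨x, hx⟩, rfl⟩
    have hx2 : 0 < ‖x‖ ^ 2 := by positivity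
    simp only [RCLike.re_to_real, ContinuousLinearMap.coe_coe]
    rw [le_div_iff₀ hx2]
    have h3 := abs_le.1 (abs_real_inner_le_norm (H x) x)
    have h4 := H.le_opNorm x
    nlinarith [norm_nonneg x]
  have h2 : q ≤ ⟪H v, v⟫_ℝ / ‖v‖ ^ 2 := ciInf_le hbdd ⟨v, hv⟩
  rw [real_inner_comm]
  exact (le_div_iff₀ hv2).1 (h1.trans h2)

lemma lambdaMin_diagonal_le {m : ℕ} (d : Fin m → ℝ) (i : Fin m) :
    lambdaMin (Matrix.diagonal d) ≤ d i := by
  unfold lambdaMin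
  rw [spectrum_diagonal]
  exact csInf_le (Set.finite_range d).bddBelow ⟨i, rfl⟩

lemma neg_lambdaMin_diagonal_le {m : ℕ} (d : Fin m → ℝ) {M : ℝ} (hM : 0 ≤ M)
    (hd : ∀ i, |d i| ≤ M) : -lambdaMin (Matrix.diagonal d) ≤ M := by
  unfold lambdaMin
  rw [spectrum_diagonal]
  rcases (Set.range d).eq_empty_or_nonempty with h | h
  · simpa [h]
  · rw [neg_le]
    refine le_csInf h ?_
    rintro _ ⟨i, rfl⟩
    exact neg_le_of_abs_le (hd i)

end LambdaMin

/-! ### The Hessian approximations -/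

section HessApprox

variable {n : ℕ} {f : Vec n → ℝ}

namespace SeparableForm

variable (s : SeparableForm f)

/-- The linear functional `x ↦ (Ax)ᵢ`. -/
def row (i : Fin s.m) : Vec n →L[ℝ] ℝ :=
  ∑ j, s.A i j • EuclideanSpace.proj j

lemma row_apply (i : Fin s.m) (x : Vec n) : s.row i x = s.A.mulVec x.ofLp i := by
  simp [row, Matrix.mulVec, dotProduct]

lemma fderiv_eq : fderiv ℝ f = fun x => ∑ i, deriv (s.φ i) (s.row i x - s.b i) • s.row i := by
  funext x
  have h : HasFDerivAt (fun x => ∑ i, s.φ i (s.row i x - s.b i))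
      (∑ i, deriv (s.φ i) (s.row i x - s.b i) • s.row i) x := by
    refine HasFDerivAt.fun_sum fun i _ => ?_
    have hφ : HasDerivAt (s.φ i) (deriv (s.φ i) (s.row i x - s.b i)) (s.row i x - s.b i) :=
      ((s.φ_contDiff i).differentiable two_ne_zero _).hasDerivAt
    exact hφ.comp_hasFDerivAt x ((s.row i).hasFDerivAt.sub_const (s.b i))
  have hf : (fun x => ∑ i, s.φ i (s.row i x - s.b i)) = f := by
    funext x
    rw [s.f_eq]
    simp [row_apply]
  rw [hf] at h
  exact h.fderiv

lemma contDiff_deriv (i : Fin s.m) : ContDiff ℝ 1 (deriv (s.φ i)) := by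
  have h : ContDiff ℝ (1 + 1) (s.φ i) := s.φ_contDiff i
  exact (contDiff_succ_iff_deriv.1 h).2.2

/-- Written as a weighted sum over the rows of `A`, the Hessian can be compared with its
approximations weight by weight. -/
lemma inner_hess_eq (hf : ContDiff ℝ 2 f) (x u w : Vec n) :
    ⟪hess f x u, w⟫_ℝ = ∑ i, s.hessDiag x i * (s.row i u * s.row i w) := by
  rw [inner_hess hf, s.fderiv_eq]
  have h : HasFDerivAt (fun x => ∑ i, deriv (s.φ i) (s.row i x - s.b i) • s.row i)
      (∑ i, (deriv (deriv (s.φ i)) (s.row i x - s.b i) • s.row i).smulRight (s.row i)) x := by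
    refine HasFDerivAt.fun_sum fun i _ => ?_
    have hφ : HasDerivAt (deriv (s.φ i)) (deriv (deriv (s.φ i)) (s.row i x - s.b i))
        (s.row i x - s.b i) :=
      ((s.contDiff_deriv i).differentiable one_ne_zero _).hasDerivAt
    have hc : HasFDerivAt (fun x => deriv (s.φ i) (s.row i x - s.b i))
        (deriv (deriv (s.φ i)) (s.row i x - s.b i) • s.row i) x :=
      HasDerivAt.comp_hasFDerivAt (h₂ := deriv (s.φ i)) x hφ
        ((s.row i).hasFDerivAt.sub_const (s.b i))
    exact hc.smul_const (s.row i)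
  rw [h.fderiv]
  simp [hessDiag, row_apply, mul_assoc]

lemma continuous_hessDiag (i : Fin s.m) : Continuous fun x => s.hessDiag x i := by
  have h : Continuous (deriv (deriv (s.φ i))) :=
    (s.contDiff_deriv i).continuous_deriv (le_refl 1)
  have h2 : (fun x => s.hessDiag x i) =
      fun x => deriv (deriv (s.φ i)) (s.row i x - s.b i) := by
    funext x
    simp [hessDiag, row_apply]
  rw [h2]
  exact h.comp (((s.row i).continuous).sub continuous_const)

lemma inner_gram (D : Fin s.m → ℝ) (u w : Vec n) :
    ⟪u, Matrix.toEuclideanCLM (n := Fin n) (𝕜 := ℝ)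
      (s.A.transpose * Matrix.diagonal D * s.A) w⟫_ℝ = ∑ i, D i * (s.row i u * s.row i w) := by
  rw [Matrix.inner_toEuclideanCLM, ← Matrix.mulVec_mulVec, ← Matrix.mulVec_mulVec,
    Matrix.dotProduct_mulVec, Matrix.vecMul_transpose]
  simp only [dotProduct, Matrix.mulVec_diagonal, row_apply]
  exact Finset.sum_congr rfl fun i _ => by ring

lemma inner_hessApprox₁ (hf : ContDiff ℝ 2 f) (b₂ ρ : ℝ) (x u w : Vec n) :
    ⟪u, s.hessApprox₁ b₂ ρ x w⟫_ℝ = (∑ i, (s.hessDiag x i +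
      b₂ * max (-lambdaMin (Matrix.diagonal (s.hessDiag x))) 0) * (s.row i u * s.row i w)) +
        ρ * ⟪u, w⟫_ℝ := by
  have h := s.inner_gram (fun _ => 1) u w
  rw [Matrix.diagonal_one, Matrix.mul_one] at h
  simp only [hessApprox₁, add_apply, map_smul, inner_add_right,
    smul_apply, real_inner_smul_right, h, ContinuousLinearMap.id_apply,
    ← inner_hess_comm hf, s.inner_hess_eq hf, add_mul, Finset.sum_add_distrib, one_mul,
    Finset.mul_sum]

lemma inner_hessApprox₂ (ρ : ℝ) (x u w : Vec n) :
    ⟪u, s.hessApprox₂ ρ x w⟫_ℝ = (∑ i, max (s.hessDiag x i) 0 * (s.row i u * s.row i w)) +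
        ρ * ⟪u, w⟫_ℝ := by
  simp only [hessApprox₂, add_apply, inner_add_right, inner_gram,
    smul_apply, real_inner_smul_right, ContinuousLinearMap.id_apply]

end SeparableForm

/-- Symmetric and bounded below by `ρ I`. -/
def RegularizedBy (ρ : ℝ) (G : Vec n →L[ℝ] Vec n) : Prop :=
  (∀ u w, ⟪G u, w⟫_ℝ = ⟪u, G w⟫_ℝ) ∧ ∀ v, ρ * ‖v‖ ^ 2 ≤ ⟪v, G v⟫_ℝ

lemma SeparableForm.regularizedBy_hessApprox₁ (s : SeparableForm f) (hf : ContDiff ℝ 2 f)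
    {b₂ : ℝ} (hb : 1 ≤ b₂) (ρ : ℝ) (x : Vec n) :
    RegularizedBy ρ (s.hessApprox₁ b₂ ρ x) := by
  constructor
  · intro u w
    rw [real_inner_comm, s.inner_hessApprox₁ hf, s.inner_hessApprox₁ hf, real_inner_comm u w]
    simp only [mul_comm (s.row _ u)]
  · intro v
    rw [s.inner_hessApprox₁ hf, real_inner_self_eq_norm_sq]
    refine le_add_of_nonneg_left (Finset.sum_nonneg fun i _ => ?_)
    refine mul_nonneg ?_ (mul_self_nonneg _)
    -- Each diagonal entry is at least the smallest eigenvalue, and `b₂ ≥ 1` makes the shift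
    -- compensate its negative part.
    have h1 := lambdaMin_diagonal_le (s.hessDiag x) i
    have h2 := le_max_left (-lambdaMin (Matrix.diagonal (s.hessDiag x))) 0
    have h3 := le_max_right (-lambdaMin (Matrix.diagonal (s.hessDiag x))) 0
    nlinarith

lemma SeparableForm.regularizedBy_hessApprox₂ (s : SeparableForm f) (ρ : ℝ) (x : Vec n) :
    RegularizedBy ρ (s.hessApprox₂ ρ x) := by
  constructor
  · intro u w
    rw [real_inner_comm, s.inner_hessApprox₂, s.inner_hessApprox₂, real_inner_comm u w]
    simp only [mul_comm (s.row _ u)]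
  · intro v
    rw [s.inner_hessApprox₂, real_inner_self_eq_norm_sq]
    exact le_add_of_nonneg_left (Finset.sum_nonneg fun i _ =>
      mul_nonneg (le_max_right _ _) (mul_self_nonneg _))

lemma regularizedBy_hessApprox₃ (hf : ContDiff ℝ 2 f) {b₂ : ℝ} (hb : 1 ≤ b₂) (ρ : ℝ)
    (x : Vec n) : RegularizedBy ρ (hessApprox₃ f b₂ ρ x) := by
  have hval : ∀ u w, ⟪u, hessApprox₃ f b₂ ρ x w⟫_ℝ = ⟪u, hess f x w⟫_ℝ +
      (b₂ * max (-lambdaMin (hess f x)) 0 + ρ) * ⟪u, w⟫_ℝ := fun u w => by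
    simp [hessApprox₃, inner_add_right, real_inner_smul_right]
  constructor
  · intro u w
    rw [real_inner_comm, hval, hval, ← inner_hess_comm hf, real_inner_comm (hess f x w) u,
      real_inner_comm u w]
  · intro v
    rw [hval, real_inner_self_eq_norm_sq]
    have h1 := lambdaMin_mul_sq_le (hess f x) (inner_hess_comm hf x) v
    have h2 := le_max_left (-lambdaMin (hess f x)) 0
    have h3 := le_max_right (-lambdaMin (hess f x)) 0
    have h4 : 0 ≤ b₂ * max (-lambdaMin (hess f x)) 0 + lambdaMin (hess f x) := by nlinarith
    nlinarith [mul_nonneg h4 (sq_nonneg ‖v‖)]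

lemma norm_hessApprox₃_le {b₂ : ℝ} (hb : 0 ≤ b₂) {ρ : ℝ} (hρ : 0 ≤ ρ) (x : Vec n) :
    ‖hessApprox₃ f b₂ ρ x‖ ≤ (1 + b₂) * ‖hess f x‖ + ρ := by
  have h0 : max (-lambdaMin (hess f x)) 0 ≤ ‖hess f x‖ :=
    max_le (neg_lambdaMin_le_norm _) (norm_nonneg _)
  have h3 := le_max_right (-lambdaMin (hess f x)) 0
  have hc : 0 ≤ b₂ * max (-lambdaMin (hess f x)) 0 + ρ := by positivity
  refine (norm_add_le _ _).trans ?_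
  rw [norm_smul, Real.norm_eq_abs, abs_of_nonneg hc]
  have h1 : ‖ContinuousLinearMap.id ℝ (Vec n)‖ ≤ 1 := ContinuousLinearMap.norm_id_le
  have h2 := mul_le_of_le_one_right hc h1
  nlinarith

/-- The smallest eigenvalue need only be bounded in terms of the continuous diagonal of `∇²h`; its
own continuity plays no role. The term `ρ` is kept apart since it varies independently of `x`. -/
lemma SeparableForm.exists_norm_hessApprox_le (s : SeparableForm f) (hf : ContDiff ℝ 2 f)
    {K : Set (Vec n)} (hK : IsCompact K) {b₂ : ℝ} (hb : 0 ≤ b₂) :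
    ∃ C, ∀ x ∈ K, ∀ ρ, 0 ≤ ρ → ‖s.hessApprox₁ b₂ ρ x‖ ≤ C + ρ ∧ ‖s.hessApprox₂ ρ x‖ ≤ C + ρ := by
  obtain ⟨C₀, hC₀⟩ := hK.exists_bound_of_continuousOn (continuous_hess hf).continuousOn
  have hdiag : Continuous fun x => s.hessDiag x := continuous_pi s.continuous_hessDiag
  obtain ⟨C₁, hC₁⟩ := hK.exists_bound_of_continuousOn hdiag.continuousOn
  have hlin : Continuous fun M : Matrix (Fin n) (Fin n) ℝ =>
      Matrix.toEuclideanCLM (n := Fin n) (𝕜 := ℝ) M :=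
    LinearMap.continuous_of_finiteDimensional
      (Matrix.toEuclideanCLM (n := Fin n) (𝕜 := ℝ)).toAlgEquiv.toLinearMap
  have hgram : Continuous fun x => Matrix.toEuclideanCLM (n := Fin n) (𝕜 := ℝ)
      (s.A.transpose * Matrix.diagonal (fun i => max (s.hessDiag x i) 0) * s.A) := by
    refine hlin.comp ?_
    have h : Continuous fun x => Matrix.diagonal (fun i => max (s.hessDiag x i) 0) :=
      Continuous.matrix_diagonal
        (continuous_pi fun i => (s.continuous_hessDiag i).max continuous_const)
    exact (continuous_const.matrix_mul h).matrix_mul continuous_const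
  obtain ⟨C₂, hC₂⟩ := hK.exists_bound_of_continuousOn hgram.continuousOn
  set E := ‖Matrix.toEuclideanCLM (n := Fin n) (𝕜 := ℝ) (s.A.transpose * s.A)‖
  have hid : ∀ ρ : ℝ, 0 ≤ ρ → ‖ρ • ContinuousLinearMap.id ℝ (Vec n)‖ ≤ ρ := fun ρ hρ => by
    rw [norm_smul, Real.norm_eq_abs, abs_of_nonneg hρ]
    exact mul_le_of_le_one_right hρ ContinuousLinearMap.norm_id_le
  refine ⟨max (C₀ + b₂ * C₁ * E) C₂, fun x hx ρ hρ => ⟨?_, ?_⟩⟩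
  · have hC : 0 ≤ C₁ := (norm_nonneg _).trans (hC₁ x hx)
    have h1 : max (-lambdaMin (Matrix.diagonal (s.hessDiag x))) 0 ≤ C₁ :=
      max_le (neg_lambdaMin_diagonal_le _ hC fun i =>
        (norm_le_pi_norm (s.hessDiag x) i).trans (hC₁ x hx)) hC
    have h0 : 0 ≤ b₂ * max (-lambdaMin (Matrix.diagonal (s.hessDiag x))) 0 := by positivity
    refine (norm_add_le _ _).trans (add_le_add ((norm_add_le _ _).trans ?_) (hid ρ hρ))
    refine le_trans ?_ (le_max_left _ _)
    rw [map_smul, norm_smul, Real.norm_eq_abs, abs_of_nonneg h0]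
    have := hC₀ x hx
    gcongr
  · refine (norm_add_le _ _).trans (add_le_add ?_ (hid ρ hρ))
    exact (hC₂ x hx).trans (le_max_right _ _)

end HessApprox

/-! ### The subdifferential of the model -/

namespace Problem

variable {n p : ℕ} (P : Problem n p)

lemma Theta_of_mem {x y : Vec n} {G : Vec n →L[ℝ] Vec n} (hy : y ∈ P.PiSet x) :
    P.Theta x G y =
      ((P.f x + ⟪∇ P.f x, y - x⟫_ℝ + 1 / 2 * ⟪y - x, G (y - x)⟫_ℝ : ℝ) : EReal) := by
  simp [Theta, indicatorFun, hy]

lemma Theta_of_notMem {x y : Vec n} {G : Vec n →L[ℝ] Vec n} (hy : y ∉ P.PiSet x) :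
    P.Theta x G y = ⊤ := by
  simp only [Theta, indicatorFun, hy, if_false, EReal.coe_add_top]

/-- `Θ` is a smooth quadratic plus the indicator of a convex set, so subtracting the gradient of the
quadratic leaves a normal. Symmetry of `G` makes that gradient `∇f(x) + G(y - x)`. Testing along
segments from `y` and dividing by the length parameter leaves only the error `ε ‖w - y‖`. -/
lemma mem_normalCone_of_mem_regularSubdiff {x y v : Vec n} {G : Vec n →L[ℝ] Vec n}
    (hG : ∀ u w, ⟪G u, w⟫_ℝ = ⟪u, G w⟫_ℝ) (hv : v ∈ regularSubdiff (P.Theta x G) y) :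
    v - ∇ P.f x - G (y - x) ∈ normalCone (P.PiSet x) y := by
  obtain ⟨htop, -, hreg⟩ := hv
  have hy : y ∈ P.PiSet x := by
    by_contra h
    exact htop (P.Theta_of_notMem h)
  refine ⟨hy, fun w hw => ?_⟩
  have key : ∀ ε > 0, ⟪v - ∇ P.f x - G (y - x), w - y⟫_ℝ ≤ ε * ‖w - y‖ := by
    intro ε hε
    have hline : Tendsto (fun s : ℝ => y + s • (w - y)) (𝓝[>] 0) (𝓝 y) := by
      have : Tendsto (fun s : ℝ => y + s • (w - y)) (𝓝 0) (𝓝 (y + (0 : ℝ) • (w - y))) :=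
        Continuous.tendsto (by fun_prop) 0
      rw [zero_smul, add_zero] at this
      exact this.mono_left nhdsWithin_le_nhds
    have hlim : Tendsto (fun s : ℝ => ε * ‖w - y‖ + s * (1 / 2 * ⟪w - y, G (w - y)⟫_ℝ))
        (𝓝[>] 0) (𝓝 (ε * ‖w - y‖)) := by
      have : Tendsto (fun s : ℝ => ε * ‖w - y‖ + s * (1 / 2 * ⟪w - y, G (w - y)⟫_ℝ)) (𝓝 0)
          (𝓝 (ε * ‖w - y‖ + 0 * (1 / 2 * ⟪w - y, G (w - y)⟫_ℝ))) :=
        Continuous.tendsto (by fun_prop) 0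
      rw [zero_mul, add_zero] at this
      exact this.mono_left nhdsWithin_le_nhds
    refine ge_of_tendsto hlim ?_
    filter_upwards [hline.eventually (hreg ε hε), Ioc_mem_nhdsGT (zero_lt_one' ℝ)] with s hs hs01
    have hmem : y + s • (w - y) ∈ P.PiSet x :=
      (P.convex_PiSet x).add_smul_sub_mem hy hw ⟨hs01.1.le, hs01.2⟩
    rw [P.Theta_of_mem hy, P.Theta_of_mem hmem, ← EReal.coe_add, EReal.coe_le_coe_iff,
      show y + s • (w - y) - x = (y - x) + s • (w - y) by module, add_sub_cancel_left, map_add,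
      map_smul, norm_smul, Real.norm_eq_abs, abs_of_pos hs01.1] at hs
    simp only [inner_add_left, inner_add_right, real_inner_smul_left, real_inner_smul_right] at hs
    have hsymm : ⟪y - x, G (w - y)⟫_ℝ = ⟪w - y, G (y - x)⟫_ℝ := by
      rw [← hG, real_inner_comm]
    rw [hsymm] at hs
    rw [inner_sub_left, inner_sub_left, real_inner_comm (w - y) (G (y - x))]
    have h3 : 0 ≤ s * (ε * ‖w - y‖ + s * (1 / 2 * ⟪w - y, G (w - y)⟫_ℝ) -
        (⟪v, w - y⟫_ℝ - ⟪∇ P.f x, w - y⟫_ℝ - ⟪w - y, G (y - x)⟫_ℝ)) := by nlinarith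
    have := (mul_nonneg_iff_of_pos_left hs01.1).1 h3
    linarith
  refine le_of_forall_pos_le_add fun ε hε => ?_
  have hpos : 0 < ‖w - y‖ + 1 := by positivity
  -- The added `1` avoids a case split on `w = y`.
  have := key (ε / (‖w - y‖ + 1)) (by positivity)
  refine this.trans ?_
  rw [zero_add, div_mul_eq_mul_div, div_le_iff₀ hpos]
  nlinarith [norm_nonneg (w - y)]

/-- The normal cone mapping of a closed set has closed graph, so the inclusion for regular
subgradients survives the limit. -/
lemma mem_normalCone_of_mem_limitingSubdiff {x y v : Vec n} {G : Vec n →L[ℝ] Vec n}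
    (hG : ∀ u w, ⟪G u, w⟫_ℝ = ⟪u, G w⟫_ℝ) (hv : v ∈ limitingSubdiff (P.Theta x G) y) :
    v - ∇ P.f x - G (y - x) ∈ normalCone (P.PiSet x) y := by
  obtain ⟨-, -, xs, vs, hxs, -, hreg, hvs⟩ := hv
  have hN := fun j => P.mem_normalCone_of_mem_regularSubdiff hG (hreg j)
  have hy : y ∈ P.PiSet x :=
    (P.isClosed_PiSet x).mem_of_tendsto hxs (Eventually.of_forall fun j => (hN j).1)
  refine ⟨hy, fun w hw => ?_⟩
  have hlim : Tendsto (fun j => ⟪vs j - ∇ P.f x - G (xs j - x), w - xs j⟫_ℝ) atTop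
      (𝓝 ⟪v - ∇ P.f x - G (y - x), w - y⟫_ℝ) :=
    ((hvs.sub_const _).sub ((G.continuous.tendsto _).comp (hxs.sub_const x))).inner
      (hxs.const_sub w)
  exact le_of_tendsto hlim (Eventually.of_forall fun j => (hN j).2 w hw)

end Problem

/-! ### Descent along the run and vanishing of the residuals -/

namespace Run

variable {n p : ℕ} {P : Problem n p} {c : Params} (R : Run P c)

/-- The accepted step parameter `μ_k τ ^ m_k`. -/
def mubar (k : ℕ) : ℝ := R.μ k * c.τ ^ R.m k

/-- The norm of the scaled proximal gradient residual. -/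
def res (k : ℕ) : ℝ := ‖R.mubar k • (R.x k - R.xbar k)‖

/-- The regularization parameter. -/
def rho (k : ℕ) : ℝ := c.b₁ * R.res k ^ c.σ

/-- The switch condition: a Newton step is taken. -/
def Switch (k : ℕ) : Prop :=
  P.supp (R.x k) = P.supp (R.xbar k) ∧ P.suppB (R.x k) = P.suppB (R.xbar k)

lemma mu_pos (k : ℕ) : 0 < R.μ k := c.μmin_pos.trans_le (R.μ_mem k).1

lemma tau_pos (c : Params) : 0 < c.τ := zero_lt_one.trans c.one_lt_τ

lemma mubar_pos (k : ℕ) : 0 < R.mubar k := mul_pos (R.mu_pos k) (pow_pos (tau_pos c) _)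

lemma μmin_le_mubar (k : ℕ) : c.μmin ≤ R.mubar k :=
  (R.μ_mem k).1.trans (le_mul_of_one_le_right (R.mu_pos k).le (one_le_pow₀ c.one_lt_τ.le))

lemma res_eq (k : ℕ) : R.res k = R.mubar k * ‖R.x k - R.xbar k‖ := by
  rw [res, norm_smul, Real.norm_eq_abs, abs_of_pos (R.mubar_pos k)]

lemma res_pos (k : ℕ) : 0 < R.res k := by
  rw [res_eq]
  exact mul_pos (R.mubar_pos k) (norm_pos_iff.2 (sub_ne_zero.2 (R.not_stopped k)))

lemma norm_sub_le_res (k : ℕ) : ‖R.x k - R.xbar k‖ ≤ c.μmin⁻¹ * R.res k := by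
  rw [res_eq, ← div_eq_inv_mul, le_div_iff₀ c.μmin_pos, mul_comm]
  exact mul_le_mul_of_nonneg_right (R.μmin_le_mubar k) (norm_nonneg _)

lemma rho_pos (k : ℕ) : 0 < R.rho k := mul_pos c.b₁_pos (Real.rpow_pos_of_pos (R.res_pos k) _)

lemma xbar_mem_box (k : ℕ) : R.xbar k ∈ P.box := P.prox_grad_mem_box (R.xbar_mem k)

lemma beta_pow_pos (c : Params) (t : ℕ) : 0 < c.β ^ t := pow_pos c.β_mem.1 t

lemma beta_pow_le_one (c : Params) (t : ℕ) : c.β ^ t ≤ 1 :=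
  pow_le_one₀ c.β_mem.1.le c.β_mem.2.le

lemma y_mem_PiSet {k : ℕ} (hk : R.Switch k) (hx : R.x k ∈ P.box) :
    R.y k ∈ P.PiSet (R.x k) := by
  by_contra h
  have := (R.newton_step k hk).1
  rw [P.Theta_of_notMem h, P.Theta_of_mem (P.self_mem_PiSet hx)] at this
  exact EReal.coe_ne_top _ (top_le_iff.1 this)

lemma x_succ_mem_PiSet {k : ℕ} (hk : R.Switch k) (hx : R.x k ∈ P.box) :
    R.x (k + 1) ∈ P.PiSet (R.x k) := by
  rw [(R.newton_step k hk).2.2.2]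
  exact (P.convex_PiSet _).add_smul_sub_mem (P.self_mem_PiSet hx) (R.y_mem_PiSet hk hx)
    ⟨(beta_pow_pos c _).le, beta_pow_le_one c _⟩

lemma x_mem_box (k : ℕ) : R.x k ∈ P.box := by
  induction k with
  | zero => exact R.x_zero_mem
  | succ k ih =>
    by_cases hk : R.Switch k
    · exact (R.x_succ_mem_PiSet hk ih).1
    · rw [R.pg_step k hk]
      exact R.xbar_mem_box k

lemma exists_hess_bound (P : Problem n p) : ∃ L, 0 < L ∧ ∀ x ∈ P.box, ‖hess P.f x‖ ≤ L := by
  obtain ⟨L, hL⟩ := P.isCompact_box.exists_bound_of_continuousOn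
    (continuous_hess P.f_contDiff).continuousOn
  exact ⟨max L 1, by positivity, fun x hx => (hL x hx).trans (le_max_left _ _)⟩

/-- Backtracking ends after a bounded number of trials. -/
lemma exists_mubar_le : ∃ M, 0 < M ∧ ∀ k, R.mubar k ≤ M := by
  obtain ⟨L, hL0, hL⟩ := exists_hess_bound P
  have hμ := c.μmin_pos.trans c.μmin_lt_μmax
  refine ⟨max c.μmax (c.τ * (2 * L + c.α)), lt_max_of_lt_left hμ, fun k => ?_⟩
  rcases Nat.eq_zero_or_pos (R.m k) with h0 | hpos
  · refine le_trans ?_ (le_max_left _ _)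
    rw [mubar, h0, pow_zero, mul_one]
    exact (R.μ_mem k).2
  · refine le_trans ?_ (le_max_right _ _)
    obtain ⟨j, hj⟩ : ∃ j, R.m k = j + 1 := ⟨R.m k - 1, by omega⟩
    obtain ⟨z, hz, hfail⟩ := R.backtrack k j (by omega)
    have hlam : 0 < R.μ k * c.τ ^ j := mul_pos (R.mu_pos k) (pow_pos (tau_pos c) _)
    have h1 := P.prox_grad_le hlam hz (R.x_mem_box k)
    have h2 := le_add_inner_gradient_add_sq P.f_contDiff P.convex_box hL (R.x_mem_box k)
      (P.prox_grad_mem_box hz)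
    rw [sub_self, norm_zero, inner_zero_right] at h1
    rw [norm_sub_rev (R.x k) z] at hfail
    -- For the last rejected parameter `ν`, optimality against `x k` and the quadratic bound give `F
    -- z ≤ F (x k) - (ν / 2 - L) ‖z - x k‖²`. Rejection thus forces `ν < 2 L + α`, and the accepted
    -- parameter is `τ ν`.
    have h3 : R.μ k * c.τ ^ j < 2 * L + c.α := by
      by_contra! hc
      apply hfail
      unfold Problem.F
      nlinarith [mul_le_mul_of_nonneg_right hc (sq_nonneg ‖z - R.x k‖)]
    rw [mubar, hj, pow_succ, ← mul_assoc, mul_comm c.τ]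
    exact mul_le_mul_of_nonneg_right h3.le (tau_pos c).le

lemma exists_norm_le_of_mem_box (P : Problem n p) : ∃ D, 0 < D ∧ ∀ x ∈ P.box, ‖x‖ ≤ D := by
  obtain ⟨D, hD⟩ := P.isCompact_box.isBounded.exists_norm_le
  exact ⟨max D 1, by positivity, fun x hx => (hD x hx).trans (le_max_left _ _)⟩

lemma exists_res_le : ∃ M, 0 < M ∧ ∀ k, R.res k ≤ M := by
  obtain ⟨M, hM, hMk⟩ := R.exists_mubar_le
  obtain ⟨D, hD, hDx⟩ := exists_norm_le_of_mem_box P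
  refine ⟨M * (D + D), by positivity, fun k => ?_⟩
  rw [res_eq]
  have h := (norm_sub_le (R.x k) (R.xbar k)).trans
    (add_le_add (hDx _ (R.x_mem_box k)) (hDx _ (R.xbar_mem_box k)))
  exact mul_le_mul (hMk k) h (norm_nonneg _) hM.le

lemma regularizedBy_G {k : ℕ} (hk : R.Switch k) : RegularizedBy (R.rho k) (R.G k) := by
  rcases R.G_rule with h | ⟨s, h⟩
  · rw [h k hk]
    exact regularizedBy_hessApprox₃ P.f_contDiff c.one_le_b₂ _ _
  · rcases h k hk with h | h | h
    · rw [h]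
      exact s.regularizedBy_hessApprox₁ P.f_contDiff c.one_le_b₂ _ _
    · rw [h]
      exact s.regularizedBy_hessApprox₂ _ _
    · rw [h]
      exact regularizedBy_hessApprox₃ P.f_contDiff c.one_le_b₂ _ _

lemma exists_norm_G_le : ∃ C, 0 < C ∧ ∀ k, R.Switch k → ‖R.G k‖ ≤ C := by
  obtain ⟨M, hM, hMk⟩ := R.exists_res_le
  obtain ⟨L, hL0, hL⟩ := exists_hess_bound P
  have hb : 0 ≤ c.b₂ := zero_le_one.trans c.one_le_b₂
  have hρ : ∀ k, R.rho k ≤ c.b₁ * M ^ c.σ := fun k =>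
    mul_le_mul_of_nonneg_left
      (Real.rpow_le_rpow (R.res_pos k).le (hMk k) c.σ_mem.1.le) c.b₁_pos.le
  have h3 : ∀ k, ‖hessApprox₃ P.f c.b₂ (R.rho k) (R.x k)‖ ≤
      (1 + c.b₂) * L + c.b₁ * M ^ c.σ := fun k =>
    (norm_hessApprox₃_le hb (R.rho_pos k).le _).trans (add_le_add
      (mul_le_mul_of_nonneg_left (hL _ (R.x_mem_box k)) (by positivity)) (hρ k))
  have h3pos : 0 < (1 + c.b₂) * L + c.b₁ * M ^ c.σ := by
    have := c.b₁_pos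
    positivity
  rcases R.G_rule with h | ⟨s, h⟩
  · refine ⟨_, h3pos, fun k hk => ?_⟩
    rw [h k hk]
    exact h3 k
  · obtain ⟨C, hC⟩ := s.exists_norm_hessApprox_le P.f_contDiff P.isCompact_box hb
    refine ⟨max ((1 + c.b₂) * L + c.b₁ * M ^ c.σ) (C + c.b₁ * M ^ c.σ),
      lt_max_of_lt_left h3pos, fun k hk => ?_⟩
    have hCk := hC _ (R.x_mem_box k) _ (R.rho_pos k).le
    rcases h k hk with h | h | h
    · rw [h]
      exact (hCk.1.trans (by linarith [hρ k])).trans (le_max_right _ _)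
    · rw [h]
      exact (hCk.2.trans (by linarith [hρ k])).trans (le_max_right _ _)
    · rw [h]
      exact (h3 k).trans (le_max_left _ _)

/-- The inexact Newton direction is a sufficient descent direction. -/
lemma inner_gradient_le {k : ℕ} (hk : R.Switch k) :
    ⟪∇ P.f (R.x k), R.y k - R.x k⟫_ℝ ≤ -(1 / 2 * (R.rho k * ‖R.y k - R.x k‖ ^ 2)) := by
  have hx := R.x_mem_box k
  have h := (R.newton_step k hk).1
  rw [P.Theta_of_mem (R.y_mem_PiSet hk hx), P.Theta_of_mem (P.self_mem_PiSet hx),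
    EReal.coe_le_coe_iff, sub_self, inner_zero_right, inner_zero_left] at h
  have := (R.regularizedBy_G hk).2 (R.y k - R.x k)
  linarith

/-- A small element of `∂Θ_k(y^k)`, in terms of the normal cone. -/
lemma exists_residual {k : ℕ} (hk : R.Switch k) : ∃ ξ : Vec n, ‖ξ‖ ≤ 3 / 4 * R.res k ∧
    ξ - ∇ P.f (R.x k) - R.G k (R.y k - R.x k) ∈ normalCone (P.PiSet (R.x k)) (R.y k) := by
  have hr := R.res_pos k
  have hm := R.mubar_pos k
  have h := (R.newton_step k hk).2.1
  change _ ≤ ENNReal.ofReal (min (R.mubar k)⁻¹ 1 / 2 * min (R.res k) (R.res k ^ (1 + c.ς))) at h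
  -- The tolerance is at most half the residual. The slack up to `3 / 4` provides an actual
  -- subgradient without attainment of the distance, and a factor below `1` suffices later.
  have hlt : Metric.infEDist 0 (limitingSubdiff (P.Theta (R.x k) (R.G k)) (R.y k)) <
      ENNReal.ofReal (3 / 4 * R.res k) := by
    refine h.trans_lt ((ENNReal.ofReal_lt_ofReal_iff (by positivity)).2 ?_)
    have h1 : min (R.mubar k)⁻¹ 1 / 2 ≤ 1 / 2 := by
      have := min_le_right (R.mubar k)⁻¹ 1
      linarith
    have h2 : min (R.res k) (R.res k ^ (1 + c.ς)) ≤ R.res k := min_le_left _ _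
    have h3 : 0 ≤ min (R.res k) (R.res k ^ (1 + c.ς)) :=
      le_min hr.le (Real.rpow_nonneg hr.le _)
    nlinarith
  obtain ⟨ξ, hξ, hd⟩ := Metric.infEDist_lt_iff.1 hlt
  refine ⟨ξ, ?_, P.mem_normalCone_of_mem_limitingSubdiff (R.regularizedBy_G hk).1 hξ⟩
  rw [edist_dist, ENNReal.ofReal_lt_ofReal_iff (by positivity), dist_zero_left] at hd
  exact hd.le

/-- Monotonicity of the normal cone: with `e = x - x̄` and `d = y - x`, the normals at `y` and `x̄`
are tested against each other and the gradient `g` cancels on addition. Here `w` stands for `G d`.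
-/
lemma inner_bound_of_normal {ξ g w e d : Vec n} {b : ℝ} (h1 : ⟪ξ - g - w, -e - d⟫_ℝ ≤ 0)
    (h2 : ⟪b • e - g, e + d⟫_ℝ ≤ 0) : b * ‖e‖ ^ 2 + ⟪d, w⟫_ℝ ≤
      -(b * ⟪e, d⟫_ℝ) + ⟪ξ, e⟫_ℝ + ⟪ξ, d⟫_ℝ - ⟪w, e⟫_ℝ := by
  rw [← real_inner_self_eq_norm_sq, real_inner_comm w d]
  simp only [inner_sub_left, inner_sub_right, inner_neg_right, inner_add_right,
    real_inner_smul_left] at h1 h2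
  linarith

/-- Two-sided bounds on the Newton direction in terms of the residual. -/
lemma exists_newton_bounds : ∃ K, 0 < K ∧ ∀ k, R.Switch k →
    R.res k ≤ K * ‖R.y k - R.x k‖ ∧ R.rho k * ‖R.y k - R.x k‖ ≤ K * R.res k ∧
    ∃ v ∈ normalCone (P.PiSet (R.x k)) (R.y k),
      ‖v + ∇ P.f (R.x k)‖ ≤ K * (R.res k + ‖R.y k - R.x k‖) := by
  obtain ⟨M, hM, hMk⟩ := R.exists_mubar_le
  obtain ⟨C, hC, hCk⟩ := R.exists_norm_G_le
  have hμ := c.μmin_pos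
  have hCμ : 0 < C * c.μmin⁻¹ := by positivity
  -- The first bound needs `7 M + 4 C`, the second `7 / 4 + C / μmin`, and the third `3 / 4` and
  -- `C`; the sum dominates all of them.
  refine ⟨7 * M + 4 * C + 7 / 4 + C * c.μmin⁻¹, by positivity, fun k hk => ?_⟩
  obtain ⟨ξ, hξ, hN⟩ := R.exists_residual hk
  have hNbar := P.mem_normalCone_prox_grad (R.mubar_pos k) (R.xbar_mem k) hk.1 hk.2
  have h1 := hN.2 _ hNbar.1
  have h2 := hNbar.2 _ hN.1
  change ⟪R.mubar k • (R.x k - R.xbar k) - _, _⟫_ℝ ≤ 0 at h2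
  have hreg := (R.regularizedBy_G hk).2 (R.y k - R.x k)
  have hGd := (R.G k).le_of_opNorm_le (hCk k hk) (R.y k - R.x k)
  have hres := R.res_eq k
  have hrpos := R.res_pos k
  have hρ := R.rho_pos k
  have hble := R.norm_sub_le_res k
  have hmpos := R.mubar_pos k
  have hmM := hMk k
  set e := R.x k - R.xbar k with he
  set d := R.y k - R.x k with hd
  set r := R.res k
  set b := R.mubar k
  have e1 : R.xbar k - R.y k = -e - d := by rw [he, hd]; abel
  have e2 : R.y k - R.xbar k = e + d := by rw [he, hd]; abel
  rw [e1] at h1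
  rw [e2] at h2
  have hmono : b * ‖e‖ ^ 2 + ⟪d, R.G k d⟫_ℝ ≤
      -(b * ⟪e, d⟫_ℝ) + ⟪ξ, e⟫_ℝ + ⟪ξ, d⟫_ℝ - ⟪R.G k d, e⟫_ℝ :=
    inner_bound_of_normal h1 h2
  have b1 := abs_le.1 (abs_real_inner_le_norm e d)
  have b2 := (abs_le.1 (abs_real_inner_le_norm ξ e)).2
  have b3 := (abs_le.1 (abs_real_inner_le_norm ξ d)).2
  have b4 := (abs_le.1 (abs_real_inner_le_norm (R.G k d) e)).1
  have hen : 0 < ‖e‖ := norm_pos_iff.2 (sub_ne_zero.2 (R.not_stopped k))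
  have hdn := norm_nonneg d
  have c1 : b * -⟪e, d⟫_ℝ ≤ b * (‖e‖ * ‖d‖) := mul_le_mul_of_nonneg_left (by linarith) hmpos.le
  have c2 : ‖ξ‖ * ‖e‖ ≤ 3 / 4 * (b * ‖e‖) * ‖e‖ :=
    mul_le_mul_of_nonneg_right (hξ.trans_eq (by rw [hres])) hen.le
  have c3 : ‖ξ‖ * ‖d‖ ≤ 3 / 4 * (b * ‖e‖) * ‖d‖ :=
    mul_le_mul_of_nonneg_right (hξ.trans_eq (by rw [hres])) hdn
  have c4 : ‖R.G k d‖ * ‖e‖ ≤ C * ‖d‖ * ‖e‖ := mul_le_mul_of_nonneg_right hGd hen.le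
  -- The inexactness consumes `3 / 4` of `b ‖e‖²`. Dropping one term on the left and dividing by
  -- `‖e‖` or by `‖d‖` yields the first two bounds.
  have hsum : 1 / 4 * b * ‖e‖ ^ 2 + R.rho k * ‖d‖ ^ 2 ≤ (7 / 4 * b + C) * ‖d‖ * ‖e‖ := by
    linarith
  have hMd : b * ‖d‖ ≤ M * ‖d‖ := mul_le_mul_of_nonneg_right hmM hdn
  have hlow : r ≤ (7 * M + 4 * C) * ‖d‖ := by
    have h0 : 0 ≤ R.rho k * ‖d‖ ^ 2 := by positivity
    have h3 : 0 ≤ ((7 / 4 * b + C) * ‖d‖ - 1 / 4 * b * ‖e‖) * ‖e‖ := by linarith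
    have := (mul_nonneg_iff_of_pos_right hen).1 h3
    linarith
  have hdpos : 0 < ‖d‖ := by
    by_contra! h0
    have : ‖d‖ = 0 := le_antisymm h0 hdn
    rw [this, mul_zero] at hlow
    linarith
  refine ⟨?_, ?_, ?_⟩
  · have : 0 ≤ (7 / 4 + C * c.μmin⁻¹) * ‖d‖ := by positivity
    linarith
  · have h0 : 0 ≤ 1 / 4 * b * ‖e‖ ^ 2 := by positivity
    have h3 : 0 ≤ ((7 / 4 * b + C) * ‖e‖ - R.rho k * ‖d‖) * ‖d‖ := by linarith
    have h4 := (mul_nonneg_iff_of_pos_right hdpos).1 h3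
    have h5 : C * ‖e‖ ≤ C * (c.μmin⁻¹ * r) := mul_le_mul_of_nonneg_left hble hC.le
    have h6 : 0 ≤ (7 * M + 4 * C) * r := by positivity
    linarith
  · refine ⟨_, hN, ?_⟩
    rw [show ξ - ∇ P.f (R.x k) - R.G k d + ∇ P.f (R.x k) = ξ - R.G k d by abel]
    have h5 := norm_sub_le ξ (R.G k d)
    have h6 : 0 ≤ (7 * M + 4 * C + 1 + C * c.μmin⁻¹) * r := by positivity
    have h7 : 0 ≤ (7 * M + 3 * C + 7 / 4 + C * c.μmin⁻¹) * ‖d‖ := by positivity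
    linarith

/-- The Armijo step sizes are bounded below by a multiple of the regularization parameter. -/
lemma exists_le_beta_pow : ∃ κ, 0 < κ ∧ ∀ k, R.Switch k →
    min 1 (κ * R.rho k) ≤ c.β ^ R.t k := by
  obtain ⟨L, hL0, hL⟩ := exists_hess_bound P
  obtain ⟨K, hK, hKk⟩ := R.exists_newton_bounds
  have hβ := c.β_mem.1
  refine ⟨c.β / (4 * L), by positivity, fun k hk => ?_⟩
  rcases Nat.eq_zero_or_pos (R.t k) with h0 | hpos
  · rw [h0, pow_zero]
    exact min_le_left _ _
  · refine (min_le_right _ _).trans ?_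
    obtain ⟨j, hj⟩ : ∃ j, R.t k = j + 1 := ⟨R.t k - 1, by omega⟩
    have hfail : ¬ (P.f (R.x k + c.β ^ j • (R.y k - R.x k)) ≤
        P.f (R.x k) + c.ϱ * c.β ^ j * ⟪∇ P.f (R.x k), R.y k - R.x k⟫_ℝ) := fun h => by
      have := (R.newton_step k hk).2.2.1.2 h
      omega
    have hx := R.x_mem_box k
    have hmem : R.x k + c.β ^ j • (R.y k - R.x k) ∈ P.box :=
      P.convex_box.add_smul_sub_mem hx (R.y_mem_PiSet hk hx).1
        ⟨(beta_pow_pos c _).le, beta_pow_le_one c _⟩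
    have h1 := le_add_inner_gradient_add_sq P.f_contDiff P.convex_box hL hx hmem
    have hs := beta_pow_pos c j
    rw [add_sub_cancel_left, real_inner_smul_right, norm_smul, Real.norm_eq_abs,
      abs_of_pos hs, mul_pow] at h1
    have h2 := R.inner_gradient_le hk
    have hdpos : 0 < ‖R.y k - R.x k‖ := by
      have h3 := (hKk k hk).1
      have h4 := R.res_pos k
      by_contra! h5
      nlinarith
    rw [hj, pow_succ, div_mul_eq_mul_div, div_le_iff₀ (by positivity)]
    set s := c.β ^ j
    set q := ⟪∇ P.f (R.x k), R.y k - R.x k⟫_ℝ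
    set d := ‖R.y k - R.x k‖
    push Not at hfail
    have hϱ := c.ϱ_mem
    have hd2 : 0 < d ^ 2 := by positivity
    have hρ := R.rho_pos k
    -- The rejected step `s` violates the Armijo test but obeys the quadratic upper bound. Since `ϱ
    -- < 1 / 2`, the descent estimate gives `s > ρ / (4 L)`, and the accepted step is `β s`.
    have h3 : 0 < s * (L * s * d ^ 2 + (1 - c.ϱ) * q) := by nlinarith
    have h4 := (mul_pos_iff_of_pos_left hs).1 h3
    have h5 : (1 - c.ϱ) * q ≤ -(1 / 4 * (R.rho k * d ^ 2)) := by
      have : 0 ≤ R.rho k * d ^ 2 := by positivity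
      nlinarith [hϱ.1, hϱ.2]
    have h6 : 0 < (L * s - 1 / 4 * R.rho k) * d ^ 2 := by nlinarith
    have h7 := (mul_pos_iff_of_pos_right hd2).1 h6
    nlinarith

/-- The decrease of the objective at a Newton step. -/
lemma F_succ_le {k : ℕ} (hk : R.Switch k) : P.F (R.x (k + 1)) ≤
    P.F (R.x k) - c.ϱ / 2 * (c.β ^ R.t k * (R.rho k * ‖R.y k - R.x k‖ ^ 2)) := by
  have hx := R.x_mem_box k
  have hmem := R.x_succ_mem_PiSet hk hx
  have hpen := P.penalty_mono hmem.2.1 hmem.2.2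
  have hN := (R.newton_step k hk).2.2
  have hdec := hN.1.1
  rw [Set.mem_ofPred_eq, ← hN.2] at hdec
  have h2 := R.inner_gradient_le hk
  have hs : 0 ≤ c.ϱ * c.β ^ R.t k := (mul_pos c.ϱ_mem.1 (beta_pow_pos c _)).le
  have h3 := mul_le_mul_of_nonneg_left h2 hs
  unfold Problem.F
  linarith

/-- The decrease of the objective, in terms of the residual alone. -/
lemma exists_decrease : ∃ ψ : ℝ → ℝ, (∀ r, 0 < r → 0 < ψ r) ∧
    (∀ r r', 0 < r → r ≤ r' → ψ r ≤ ψ r') ∧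
      ∀ k, P.F (R.x (k + 1)) ≤ P.F (R.x k) - ψ (R.res k) := by
  obtain ⟨M, hM, hMk⟩ := R.exists_mubar_le
  obtain ⟨K, hK, hKk⟩ := R.exists_newton_bounds
  obtain ⟨κ, hκ, hκk⟩ := R.exists_le_beta_pow
  have hb := c.b₁_pos
  have hα := c.α_pos
  have hϱ := c.ϱ_mem.1
  have hσ := c.σ_mem.1
  -- The first entry is the decrease of a proximal gradient step, where `‖x - x̄‖ ≥ r / M`; the
  -- second that of a Newton step, where `‖d‖ ≥ r / K`.
  refine ⟨fun r => min (c.α / 2 * (M⁻¹ * r) ^ 2)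
    (c.ϱ / 2 * (min 1 (κ * (c.b₁ * r ^ c.σ)) * (c.b₁ * r ^ c.σ * (K⁻¹ * r) ^ 2))), ?_, ?_, ?_⟩
  · intro r hr
    have := Real.rpow_pos_of_pos hr c.σ
    positivity
  · intro r r' hr hrr
    have h1 := Real.rpow_le_rpow hr.le hrr hσ.le
    have h2 := Real.rpow_pos_of_pos hr c.σ
    have h3 := h2.trans_le h1
    dsimp only
    gcongr
  · intro k
    by_cases hk : R.Switch k
    · refine (R.F_succ_le hk).trans (sub_le_sub_left ((min_le_right _ _).trans ?_) _)
      have h1 := hκk k hk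
      have h2 : K⁻¹ * R.res k ≤ ‖R.y k - R.x k‖ := by
        rw [← div_eq_inv_mul, div_le_iff₀ hK, mul_comm]
        exact (hKk k hk).1
      have h3 := R.rho_pos k
      have h4 := R.res_pos k
      have h5 := beta_pow_pos c (R.t k)
      change c.ϱ / 2 * (min 1 (κ * R.rho k) * (R.rho k * (K⁻¹ * R.res k) ^ 2)) ≤ _
      gcongr
    · have h := R.xbar_decrease k
      rw [R.pg_step k hk]
      refine h.trans (sub_le_sub_left ((min_le_left _ _).trans ?_) _)
      have h2 : M⁻¹ * R.res k ≤ ‖R.x k - R.xbar k‖ := by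
        rw [← div_eq_inv_mul, div_le_iff₀ hM, mul_comm, res_eq]
        exact mul_le_mul_of_nonneg_right (hMk k) (norm_nonneg _)
      have h4 := R.res_pos k
      gcongr

/-- The values of `F` decrease and are bounded below, so their successive differences vanish,
whereas a residual of size at least `ε` would cost at least `ψ ε > 0`. -/
lemma tendsto_res : Tendsto R.res atTop (𝓝 0) := by
  obtain ⟨ψ, hψ, hmono, hdec⟩ := R.exists_decrease
  have hanti : Antitone fun k => P.F (R.x k) := antitone_nat_of_succ_le fun k =>
    (hdec k).trans (sub_le_self _ (hψ _ (R.res_pos k)).le)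
  obtain ⟨C, hC⟩ := P.isCompact_box.exists_bound_of_continuousOn
    P.f_contDiff.continuous.continuousOn
  have hbdd : BddBelow (Set.range fun k => P.F (R.x k)) := by
    refine ⟨-C, ?_⟩
    rintro _ ⟨k, rfl⟩
    have h1 := neg_le_of_abs_le (hC _ (R.x_mem_box k))
    have h2 := P.penalty_nonneg (R.x k)
    simp only [Problem.F]
    linarith
  have hlim := tendsto_atTop_ciInf hanti hbdd
  have hdiff : Tendsto (fun k => P.F (R.x k) - P.F (R.x (k + 1))) atTop (𝓝 0) := by
    simpa using hlim.sub ((tendsto_add_atTop_iff_nat 1).2 hlim)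
  rw [Metric.tendsto_atTop']
  intro ε hε
  obtain ⟨N, hN⟩ := eventually_atTop.1 (hdiff.eventually_lt_const (hψ ε hε))
  refine ⟨N, fun k hk => ?_⟩
  rw [Real.dist_eq, sub_zero, abs_of_pos (R.res_pos k)]
  by_contra! h
  have h1 := hN k hk.le
  have h2 := hmono _ _ hε h
  have h3 := hdec k
  linarith

/-- The Newton directions tend to `0`. -/
lemma exists_direction_bound : ∃ δ : ℕ → ℝ, Tendsto δ atTop (𝓝 0) ∧ ∀ k, 0 ≤ δ k ∧
    (R.Switch k → ‖R.y k - R.x k‖ ≤ δ k) := by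
  obtain ⟨K, hK, hKk⟩ := R.exists_newton_bounds
  have hb := c.b₁_pos
  -- Divide `ρ_k ‖d^k‖ ≤ K r_k` by `ρ_k = b₁ r_k ^ σ`; the remaining exponent is positive.
  refine ⟨fun k => K / c.b₁ * R.res k ^ (1 - c.σ), ?_, fun k => ⟨?_, fun hk => ?_⟩⟩
  · have h1 : 0 < 1 - c.σ := by linarith [c.σ_mem.2]
    have h2 := (R.tendsto_res.rpow_const (p := 1 - c.σ) (Or.inr h1.le)).const_mul (K / c.b₁)
    simpa [Real.zero_rpow h1.ne'] using h2
  · have := Real.rpow_nonneg (R.res_pos k).le (1 - c.σ)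
    positivity
  · have h := (hKk k hk).2.1
    have hr := R.res_pos k
    have hrσ := Real.rpow_pos_of_pos hr c.σ
    dsimp only
    rw [Real.rpow_sub hr, Real.rpow_one, div_mul_div_comm, le_div_iff₀ (by positivity)]
    unfold rho at h
    linarith

lemma tendsto_xbar_sub : Tendsto (fun k => R.xbar k - R.x k) atTop (𝓝 0) := by
  have h := R.tendsto_res.const_mul c.μmin⁻¹
  rw [mul_zero] at h
  refine squeeze_zero_norm (fun k => ?_) h
  rw [norm_sub_rev]
  exact R.norm_sub_le_res k

lemma tendsto_x_succ_sub : Tendsto (fun k => R.x (k + 1) - R.x k) atTop (𝓝 0) := by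
  obtain ⟨δ, hδ, hδk⟩ := R.exists_direction_bound
  have h := (R.tendsto_res.const_mul c.μmin⁻¹).add hδ
  rw [mul_zero, add_zero] at h
  refine squeeze_zero_norm (fun k => ?_) h
  have hμ := c.μmin_pos
  have hr := R.res_pos k
  by_cases hk : R.Switch k
  · rw [(R.newton_step k hk).2.2.2, add_sub_cancel_left, norm_smul, Real.norm_eq_abs,
      abs_of_pos (beta_pow_pos c _)]
    have h1 := mul_le_of_le_one_left (norm_nonneg (R.y k - R.x k)) (beta_pow_le_one c (R.t k))
    have h2 := (hδk k).2 hk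
    have h3 : 0 ≤ c.μmin⁻¹ * R.res k := by positivity
    linarith
  · rw [R.pg_step k hk, norm_sub_rev]
    linarith [R.norm_sub_le_res k, (hδk k).1]

/-! ### Stabilization of the supports -/

/-- Proximal points have small supports: any nearby feasible points have larger ones. -/
lemma eventually_supp_xbar_subset {w : ℕ → Vec n}
    (hlim : Tendsto (fun k => w k - R.xbar k) atTop (𝓝 0)) :
    ∀ᶠ k in atTop, P.supp (R.xbar k) ⊆ P.supp (w k) ∧ P.suppB (R.xbar k) ⊆ P.suppB (w k) := by
  by_contra hcon
  rw [not_eventually] at hcon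
  obtain ⟨θ, hθ, hbad⟩ := extraction_of_frequently_atTop hcon
  obtain ⟨a, ha, η, hη, hconv⟩ :=
    P.isCompact_box.tendsto_subseq (x := fun j => R.xbar (θ j)) fun j => R.xbar_mem_box _
  have hφ : Tendsto (θ ∘ η) atTop atTop := (hθ.comp hη).tendsto_atTop
  have hwconv : Tendsto (fun j => w (θ (η j))) atTop (𝓝 a) := by
    simpa using (hlim.comp hφ).add hconv
  obtain ⟨M, hM, hMk⟩ := R.exists_mubar_le
  obtain ⟨D, hD, hDx⟩ := exists_norm_le_of_mem_box P
  obtain ⟨C, hC⟩ := P.isCompact_box.exists_bound_of_continuousOn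
    (continuous_gradient P.f_contDiff).continuousOn
  -- The limit `a` is used as competitor in the proximal problem: the smooth part differs by
  -- `O(‖x̄^k - a‖)`, so the penalty exceeds that of `a` by no more.
  have hjump : ∀ k, P.penalty (R.xbar k) ≤
      P.penalty a + (M / 2 * (4 * D) + C) * ‖R.xbar k - a‖ := by
    intro k
    have h1 := P.prox_grad_le (R.mubar_pos k) (R.xbar_mem k) ha
    have hx := hDx _ (R.x_mem_box k)
    have hxb := hDx _ (R.xbar_mem_box k)
    have ha' := hDx _ ha
    have h2 := (norm_sub_le a (R.x k)).trans (add_le_add ha' hx)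
    have h3 := (norm_sub_le (R.xbar k) (R.x k)).trans (add_le_add hxb hx)
    have h4 : ‖a - R.x k‖ - ‖R.xbar k - R.x k‖ ≤ ‖R.xbar k - a‖ := by
      have := norm_sub_norm_le (a - R.x k) (R.xbar k - R.x k)
      rwa [sub_sub_sub_cancel_right, norm_sub_rev a (R.xbar k)] at this
    have h5 : ‖a - R.x k‖ ^ 2 - ‖R.xbar k - R.x k‖ ^ 2 ≤ 4 * D * ‖R.xbar k - a‖ := by
      have e1 := norm_nonneg (a - R.x k)
      have e2 := norm_nonneg (R.xbar k - R.x k)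
      have e3 := norm_nonneg (R.xbar k - a)
      nlinarith
    have h6 : R.mubar k / 2 * (‖a - R.x k‖ ^ 2 - ‖R.xbar k - R.x k‖ ^ 2) ≤
        M / 2 * (4 * D * ‖R.xbar k - a‖) := by
      have e3 : 0 ≤ 4 * D * ‖R.xbar k - a‖ := by positivity
      exact (mul_le_mul_of_nonneg_left h5 (by linarith [R.mubar_pos k])).trans
        (mul_le_mul_of_nonneg_right (by linarith [hMk k]) e3)
    have h7 : ⟪∇ P.f (R.x k), a - R.x k⟫_ℝ - ⟪∇ P.f (R.x k), R.xbar k - R.x k⟫_ℝ ≤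
        C * ‖R.xbar k - a‖ := by
      rw [← inner_sub_right, sub_sub_sub_cancel_right, norm_sub_rev]
      exact (real_inner_le_norm _ _).trans
        (mul_le_mul_of_nonneg_right (hC _ (R.x_mem_box k)) (norm_nonneg _))
    linarith
  have hsmall : ∀ᶠ j in atTop,
      (M / 2 * (4 * D) + C) * ‖R.xbar (θ (η j)) - a‖ < min P.lam₁ P.lam₂ := by
    have h := ((hconv.sub_const a).norm).const_mul (M / 2 * (4 * D) + C)
    rw [sub_self, norm_zero, mul_zero] at h
    exact h.eventually_lt_const (lt_min P.lam₁_pos P.lam₂_pos)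
  obtain ⟨j, hj1, hj2, hj3⟩ := (hsmall.and ((hconv.eventually (P.eventually_supp_subset a)).and
    (hwconv.eventually (P.eventually_supp_subset a)))).exists
  -- Near `a` supports can only grow, and the excess penalty is below one jump, so `x̄` has the
  -- supports of `a`, which the nearby `w` contains.
  have heq := P.supp_eq_of_penalty_lt hj2.1 hj2.2
    ((hjump (θ (η j))).trans_lt (by linarith))
  exact hbad (η j) ⟨heq.1 ▸ hj3.1, heq.2 ▸ hj3.2⟩

/-- Comparing `x̄^k` with both of its neighbours in the sequence freezes its supports. After a
Newton step, `x^{k+1}` has supports inside those of `x^k`, equal to those of `x̄^k`, and containing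
those of `x̄^{k+1}`; after a proximal step it is `x̄^k` itself. -/
lemma exists_supportsStableAfter : ∃ k, R.SupportsStableAfter k := by
  have hx : Tendsto (fun k => R.x k - R.xbar k) atTop (𝓝 0) := by
    simpa using R.tendsto_xbar_sub.neg
  have hxb : Tendsto (fun k => R.xbar (k + 1) - R.xbar k) atTop (𝓝 0) := by
    have h := (((tendsto_add_atTop_iff_nat 1).2 R.tendsto_xbar_sub).add
      R.tendsto_x_succ_sub).add hx
    rw [add_zero, add_zero] at h
    refine h.congr fun k => ?_
    abel
  -- Only indices `k + 1` matter, so the truncated subtraction is harmless.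
  have hxb' : Tendsto (fun k => R.xbar (k - 1) - R.xbar k) atTop (𝓝 0) := by
    rw [← tendsto_add_atTop_iff_nat 1]
    simpa using hxb.neg
  have h1 := R.eventually_supp_xbar_subset hx
  have h2 := R.eventually_supp_xbar_subset hxb
  have h3 := (tendsto_add_atTop_nat 1).eventually (R.eventually_supp_xbar_subset hxb')
  obtain ⟨k₀, hk₀⟩ := eventually_atTop.1 (h1.and (h2.and h3))
  have hbar : ∀ k, k₀ ≤ k → P.suppB (R.xbar k) = P.suppB (R.xbar k₀) ∧
      P.supp (R.xbar k) = P.supp (R.xbar k₀) := by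
    intro k hk
    induction k, hk using Nat.le_induction with
    | base => exact ⟨rfl, rfl⟩
    | succ k hk ih =>
      obtain ⟨-, h2, h3⟩ := hk₀ k hk
      exact ⟨(h3.2.antisymm h2.2).trans ih.1, (h3.1.antisymm h2.1).trans ih.2⟩
  refine ⟨k₀, P.suppB (R.xbar k₀), P.supp (R.xbar k₀), fun k hk => ?_⟩
  obtain ⟨j, rfl⟩ : ∃ j, k = j + 1 := ⟨k - 1, by omega⟩
  have hj : k₀ ≤ j := by omega
  have hb := hbar j hj
  have hb' := hbar (j + 1) (by omega)
  have hsup : P.suppB (R.x (j + 1)) = P.suppB (R.xbar k₀) ∧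
      P.supp (R.x (j + 1)) = P.supp (R.xbar k₀) := by
    by_cases hS : R.Switch j
    · have hmem := R.x_succ_mem_PiSet hS (R.x_mem_box j)
      have hle := (hk₀ (j + 1) (by omega)).1
      rw [hb'.1, hb'.2] at hle
      constructor
      · exact (hmem.2.2.trans (hS.2.trans hb.1).le).antisymm hle.2
      · exact (hmem.2.1.trans (hS.1.trans hb.2).le).antisymm hle.1
    · rw [R.pg_step j hS]
      exact hb
  exact ⟨hsup.1, hb'.1, hsup.2, hb'.2⟩

end Run

/-! ### Identification of the active bounds -/

lemma isClosed_normalCone {n : ℕ} {C : Set (Vec n)} {x : Vec n} (hx : x ∈ C) :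
    IsClosed (normalCone C x) := by
  obtain ⟨N, hN⟩ := exists_properCone_eq_normalCone hx
  rw [hN]
  exact N.isClosed

lemma add_mem_normalCone {n : ℕ} {C : Set (Vec n)} {x v w : Vec n} (hv : v ∈ normalCone C x)
    (hw : w ∈ normalCone C x) : v + w ∈ normalCone C x := by
  refine ⟨hv.1, fun z hz => ?_⟩
  rw [inner_add_left]
  exact add_nonpos (hv.2 z hz) (hw.2 z hz)

/-- The line through `v` and `v + w` lies in the affine span, where `C` is a neighbourhood of `v`; a
small move backwards therefore stays in `C`. -/
lemma exists_sub_smul_mem_of_mem_intrinsicInterior {n : ℕ} {C : Set (Vec n)} {v w : Vec n}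
    (hv : v ∈ intrinsicInterior ℝ C) (hvw : v + w ∈ C) : ∃ ε : ℝ, 0 < ε ∧ v - ε • w ∈ C := by
  have hvC : v ∈ C := intrinsicInterior_subset hv
  obtain ⟨⟨v', hv'⟩, hint, rfl⟩ := hv
  simp only at hvw hvC ⊢
  have hline : ∀ ε : ℝ, v' - ε • w ∈ affineSpan ℝ C := by
    intro ε
    have h := AffineMap.lineMap_mem (-ε) (subset_affineSpan ℝ C hvC) (subset_affineSpan ℝ C hvw)
    simpa [AffineMap.lineMap_apply, sub_eq_neg_add] using h
  have hcont : Continuous fun ε : ℝ => (⟨v' - ε • w, hline ε⟩ : affineSpan ℝ C) :=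
    Continuous.subtype_mk (by fun_prop) _
  have h0 : (⟨v' - (0 : ℝ) • w, hline 0⟩ : affineSpan ℝ C) = ⟨v', hv'⟩ := by simp
  have hev : ∀ᶠ ε : ℝ in 𝓝 0, v' - ε • w ∈ C := by
    have h1 : interior (((↑) : affineSpan ℝ C → Vec n) ⁻¹' C) ∈
        𝓝 (⟨v' - (0 : ℝ) • w, hline 0⟩ : affineSpan ℝ C) := by
      rw [h0]
      exact isOpen_interior.mem_nhds hint
    filter_upwards [hcont.continuousAt.preimage_mem_nhds h1] with ε hε
    exact (interior_subset hε : _ ∈ ((↑) : affineSpan ℝ C → Vec n) ⁻¹' C)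
  obtain ⟨ε, hε, hpos⟩ := ((hev.filter_mono nhdsWithin_le_nhds).and
    (self_mem_nhdsWithin : Set.Ioi (0 : ℝ) ∈ 𝓝[>] 0)).exists
  exact ⟨ε, hpos, hε⟩

/-- A point at which some relatively interior normal of `x` is normal lies in every supporting
halfspace boundary through `x`. -/
lemma inner_sub_nonneg_of_mem_intrinsicInterior {n : ℕ} {C : Set (Vec n)} {x y v w : Vec n}
    (hx : x ∈ C) (hv : v ∈ intrinsicInterior ℝ (normalCone C x)) (hvy : v ∈ normalCone C y)
    (hw : w ∈ normalCone C x) : 0 ≤ ⟪w, y - x⟫_ℝ := by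
  obtain ⟨ε, hε, hmem⟩ := exists_sub_smul_mem_of_mem_intrinsicInterior hv
    (add_mem_normalCone (intrinsicInterior_subset hv) hw)
  have h1 := hmem.2 y hvy.1
  have h2 := hvy.2 x hx
  rw [inner_sub_left, real_inner_smul_left] at h1
  rw [← neg_sub y x, inner_neg_right] at h2
  have h3 : 0 ≤ ε * ⟪w, y - x⟫_ℝ := by linarith
  exact (mul_nonneg_iff_of_pos_left hε).1 h3

namespace Problem

variable {n p : ℕ} (P : Problem n p)

/-- A bound active at `x` makes a signed coordinate vector normal at `x`. Tested against `y` it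
gives the inequality opposite to feasibility, so the bound is active at `y`. -/
lemma activeSet_subset_of_mem_intrinsicInterior {z x y v : Vec n} (hx : x ∈ P.PiSet z)
    (hv : v ∈ intrinsicInterior ℝ (normalCone (P.PiSet z) x))
    (hvy : v ∈ normalCone (P.PiSet z) y) : P.activeSet x ⊆ P.activeSet y := by
  have hin : ∀ (i : Fin n) (a : ℝ) (w : Vec n),
      ⟪EuclideanSpace.single i a, w - x⟫_ℝ = a * (w i - x i) := fun i a w => by
    simp [EuclideanSpace.inner_single_left]
  rw [activeSet_subset_iff]
  constructor
  · intro i hi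
    have hN : EuclideanSpace.single i (-1 : ℝ) ∈ normalCone (P.PiSet z) x :=
      ⟨hx, fun w hw => by rw [hin, hi]; linarith [(hw.1 i).1]⟩
    have h := inner_sub_nonneg_of_mem_intrinsicInterior hx hv hvy hN
    rw [hin, hi] at h
    linarith [(hvy.1.1 i).1]
  · intro i hi
    have hN : EuclideanSpace.single i (1 : ℝ) ∈ normalCone (P.PiSet z) x :=
      ⟨hx, fun w hw => by rw [hin, hi]; linarith [(hw.1 i).2]⟩
    have h := inner_sub_nonneg_of_mem_intrinsicInterior hx hv hvy hN
    rw [hin, hi] at h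
    linarith [(hvy.1.1 i).2]

lemma PiSet_congr {z z' : Vec n} (h : P.supp z = P.supp z') (hB : P.suppB z = P.suppB z') :
    P.PiSet z = P.PiSet z' := by
  unfold PiSet
  rw [h, hB]

/-- Finite identification: normals that converge to a relatively interior normal force the active
bounds to agree with those of the limit. -/
lemma eventually_activeSet_eq {z x v : Vec n} {ys vs : ℕ → Vec n}
    (hv : v ∈ intrinsicInterior ℝ (normalCone (P.PiSet z) x))
    (hys : Tendsto ys atTop (𝓝 x)) (hvs : Tendsto vs atTop (𝓝 v))
    (hmem : ∀ᶠ j in atTop, vs j ∈ normalCone (P.PiSet z) (ys j)) :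
    ∀ᶠ j in atTop, P.activeSet (ys j) = P.activeSet x := by
  have hx : x ∈ P.PiSet z := (intrinsicInterior_subset hv).1
  -- There are finitely many candidates. If a wrong `A` recurred forever, the normal cone would be
  -- the same closed set along that subsequence, so `v` would belong to it and `activeSet x ⊆ A`;
  -- near `x` the reverse inclusion holds.
  have hev : ∀ A : Set (Fin (n + n)), A ≠ P.activeSet x →
      ∀ᶠ j in atTop, P.activeSet (ys j) ≠ A := by
    intro A hA
    by_contra hcon
    simp only [not_eventually, not_not] at hcon
    obtain ⟨θ, hθ, hθA⟩ := extraction_of_frequently_atTop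
      (hcon.and_eventually (hmem.and (hys.eventually (P.eventually_activeSet_subset x))))
    have hmem0 : ys (θ 0) ∈ P.PiSet z := (hθA 0).2.1.1
    have hlim : v ∈ normalCone (P.PiSet z) (ys (θ 0)) := by
      refine (isClosed_normalCone hmem0).mem_of_tendsto (hvs.comp hθ.tendsto_atTop)
        (Eventually.of_forall fun j => ?_)
      exact P.normalCone_PiSet_mono (hθA j).2.1.1 hmem0 ((hθA j).1.trans (hθA 0).1.symm).le
        (hθA j).2.1
    have hsub := P.activeSet_subset_of_mem_intrinsicInterior hx hv hlim
    exact hA ((hθA 0).1.symm.trans ((hθA 0).2.2.antisymm hsub))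
  have hall : ∀ᶠ j in atTop, ∀ A : Set (Fin (n + n)), A ≠ P.activeSet x →
      P.activeSet (ys j) ≠ A := by
    rw [eventually_all]
    intro A
    by_cases hA : A = P.activeSet x
    · simp [hA]
    · filter_upwards [hev A hA] with j hj _ using hj
  filter_upwards [hall] with j hj
  by_contra h
  exact hj _ h rfl

end Problem

/-! ### Eventual constancy of the active bounds along the run -/

namespace Run

variable {n p : ℕ} {P : Problem n p} {c : Params} (R : Run P c)

lemma SupportsStableAfter.switch {R : Run P c} {kbar k : ℕ} (h : R.SupportsStableAfter kbar)
    (hk : kbar < k) : R.Switch k := by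
  obtain ⟨T, S, hTS⟩ := h
  obtain ⟨h1, h2, h3, h4⟩ := hTS k hk
  exact ⟨h3.trans h4.symm, h1.trans h2.symm⟩

lemma SupportsStableAfter.PiSet_eq {R : Run P c} {kbar k : ℕ} (h : R.SupportsStableAfter kbar)
    (hk : kbar < k) : P.PiSet (R.x k) = P.PiSet (R.x (kbar + 1)) := by
  obtain ⟨T, S, hTS⟩ := h
  obtain ⟨h1, -, h3, -⟩ := hTS k hk
  obtain ⟨h1', -, h3', -⟩ := hTS (kbar + 1) (Nat.lt_succ_self _)
  exact P.PiSet_congr (h3.trans h3'.symm) (h1.trans h1'.symm)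

lemma tendsto_y_sub {kbar : ℕ} (h : R.SupportsStableAfter kbar) :
    Tendsto (fun k => R.y k - R.x k) atTop (𝓝 0) := by
  obtain ⟨δ, hδ, hδk⟩ := R.exists_direction_bound
  refine squeeze_zero_norm' ?_ hδ
  filter_upwards [eventually_gt_atTop kbar] with k hk using (hδk k).2 (h.switch hk)

/-- Along any subsequence for which `y^k` converges, the active bounds of `y^k` are eventually
those of the limit. -/
lemma eventually_activeSet_y_eq {kbar : ℕ} (h : R.SupportsStableAfter kbar)
    (hri : ∀ xs ∈ R.accPts, (0 : Vec n) ∈ ({∇ P.f xs} : Set (Vec n)) +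
      intrinsicInterior ℝ (normalCone (P.PiSet (R.x (kbar + 1))) xs))
    {φ : ℕ → ℕ} (hφ : Tendsto φ atTop atTop) {a : Vec n}
    (hy : Tendsto (fun j => R.y (φ j)) atTop (𝓝 a)) :
    ∀ᶠ j in atTop, P.activeSet (R.y (φ j)) = P.activeSet a := by
  have hd := R.tendsto_y_sub h
  have hx : Tendsto (fun j => R.x (φ j)) atTop (𝓝 a) := by
    have := hy.sub (hd.comp hφ)
    simpa using this
  -- As `y^k - x^k → 0`, the limit is also an accumulation point of `x^k`, where the relative
  -- interior condition applies.
  have ha : a ∈ R.accPts := MapClusterPt.of_comp hφ hx.mapClusterPt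
  have hv : -∇ P.f a ∈ intrinsicInterior ℝ (normalCone (P.PiSet (R.x (kbar + 1))) a) := by
    obtain ⟨u, hu, w, hw, huw⟩ := hri a ha
    rw [Set.mem_singleton_iff] at hu
    subst hu
    rwa [← eq_neg_of_add_eq_zero_right huw]
  obtain ⟨K, hK, hKk⟩ := R.exists_newton_bounds
  have hex : ∀ k, ∃ v : Vec n, kbar < k → v ∈ normalCone (P.PiSet (R.x (kbar + 1))) (R.y k) ∧
      ‖v + ∇ P.f (R.x k)‖ ≤ K * (R.res k + ‖R.y k - R.x k‖) := by
    intro k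
    by_cases hk : kbar < k
    · obtain ⟨v, hv, hvn⟩ := (hKk k (h.switch hk)).2.2
      rw [h.PiSet_eq hk] at hv
      exact ⟨v, fun _ => ⟨hv, hvn⟩⟩
    -- A dummy value, so that the normals form a sequence over all indices.
    · exact ⟨0, fun h' => absurd h' hk⟩
  choose v hvk using hex
  have hsmall : Tendsto (fun k => v k + ∇ P.f (R.x k)) atTop (𝓝 0) := by
    have h0 := (R.tendsto_res.add hd.norm).const_mul K
    rw [norm_zero, add_zero, mul_zero] at h0
    refine squeeze_zero_norm' ?_ h0
    filter_upwards [eventually_gt_atTop kbar] with k hk using (hvk k hk).2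
  have hgrad : Tendsto (fun j => ∇ P.f (R.x (φ j))) atTop (𝓝 (∇ P.f a)) :=
    ((continuous_gradient P.f_contDiff).tendsto a).comp hx
  have hvlim : Tendsto (fun j => v (φ j)) atTop (𝓝 (-∇ P.f a)) := by
    have := (hsmall.comp hφ).sub hgrad
    simpa using this
  refine P.eventually_activeSet_eq hv hy hvlim ?_
  filter_upwards [hφ.eventually_gt_atTop kbar] with j hj using (hvk _ hj).1

/-- Different accumulation points could have different active sets. But if the active set changed
infinitely often, a subsequence of such `y^k` would share its limit with the successors `y^{k+1}`,
and identification at that limit would make both active sets equal. -/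
lemma exists_activeSet_y_eq {kbar : ℕ} (h : R.SupportsStableAfter kbar)
    (hri : ∀ xs ∈ R.accPts, (0 : Vec n) ∈ ({∇ P.f xs} : Set (Vec n)) +
      intrinsicInterior ℝ (normalCone (P.PiSet (R.x (kbar + 1))) xs)) :
    ∃ A : Set (Fin (n + n)), ∀ᶠ k in atTop, P.activeSet (R.y k) = A := by
  have hd := R.tendsto_y_sub h
  have hysucc : Tendsto (fun k => R.y (k + 1) - R.y k) atTop (𝓝 0) := by
    have h1 := (((tendsto_add_atTop_iff_nat 1).2 hd).add R.tendsto_x_succ_sub).sub hd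
    rw [add_zero, sub_zero] at h1
    refine h1.congr fun k => ?_
    abel
  have hstep : ∀ᶠ k in atTop, P.activeSet (R.y (k + 1)) = P.activeSet (R.y k) := by
    by_contra hcon
    rw [not_eventually] at hcon
    obtain ⟨θ, hθ, hθA⟩ := extraction_of_frequently_atTop
      (hcon.and_eventually (eventually_gt_atTop kbar))
    obtain ⟨a, -, η, hη, hconv⟩ := P.isCompact_box.tendsto_subseq (x := fun j => R.y (θ j))
      fun j => (R.y_mem_PiSet (h.switch (hθA j).2) (R.x_mem_box _)).1
    have hφ : Tendsto (fun j => θ (η j)) atTop atTop := (hθ.comp hη).tendsto_atTop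
    have hconv' : Tendsto (fun j => R.y (θ (η j) + 1)) atTop (𝓝 a) := by
      have := (hysucc.comp hφ).add hconv
      simpa using this
    have h1 := R.eventually_activeSet_y_eq h hri hφ hconv
    have h2 := R.eventually_activeSet_y_eq h hri ((tendsto_add_atTop_nat 1).comp hφ) hconv'
    obtain ⟨j, hj1, hj2⟩ := (h1.and h2).exists
    exact (hθA (η j)).1 (hj2.trans hj1.symm)
  obtain ⟨N, hN⟩ := eventually_atTop.1 hstep
  refine ⟨P.activeSet (R.y N), eventually_atTop.2 ⟨N, fun k hk => ?_⟩⟩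
  induction k, hk using Nat.le_induction with
  | base => rfl
  | succ k hk ih => rw [hN k hk, ih]

/-- A Newton step either passes to the active bounds of `y^k` or keeps the common ones. -/
lemma activeSet_x_succ {k : ℕ} (hk : R.Switch k) :
    P.activeSet (R.x (k + 1)) = P.activeSet (R.y k) ∨
      P.activeSet (R.x (k + 1)) = P.activeSet (R.x k) ∩ P.activeSet (R.y k) := by
  have hx := R.x_mem_box k
  rw [(R.newton_step k hk).2.2.2]
  rcases Nat.eq_zero_or_pos (R.t k) with h0 | hpos
  · left
    rw [h0, pow_zero, one_smul, add_sub_cancel]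
  · right
    exact P.activeSet_add_smul hx (R.y_mem_PiSet hk hx).1 (beta_pow_pos c _)
      (pow_lt_one₀ c.β_mem.1.le c.β_mem.2 hpos.ne')

lemma exists_activeSet_x_eq {kbar : ℕ} (h : R.SupportsStableAfter kbar)
    (hri : ∀ xs ∈ R.accPts, (0 : Vec n) ∈ ({∇ P.f xs} : Set (Vec n)) +
      intrinsicInterior ℝ (normalCone (P.PiSet (R.x (kbar + 1))) xs)) :
    ∃ A : Set (Fin (n + n)), ∀ᶠ k in atTop, P.activeSet (R.x k) = A := by
  obtain ⟨A, hA⟩ := R.exists_activeSet_y_eq h hri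
  obtain ⟨N, hN⟩ := eventually_atTop.1 (hA.and (eventually_gt_atTop kbar))
  have hstep : ∀ k, N ≤ k → P.activeSet (R.x (k + 1)) = A ∨
      P.activeSet (R.x (k + 1)) = P.activeSet (R.x k) ∩ A := by
    intro k hk
    rw [← (hN k hk).1]
    exact R.activeSet_x_succ (h.switch (hN k hk).2)
  -- Each step turns the active set into `A` or intersects it with `A`. Once equal to `A` it stays
  -- so; if it never is, every step intersects, and intersecting again changes nothing after the
  -- first time.
  by_cases hhit : ∃ K, N ≤ K ∧ P.activeSet (R.x K) = A
  · obtain ⟨K, hNK, hK⟩ := hhit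
    refine ⟨A, eventually_atTop.2 ⟨K, fun k hk => ?_⟩⟩
    induction k, hk using Nat.le_induction with
    | base => exact hK
    | succ k hk ih =>
      rcases hstep k (hNK.trans hk) with h' | h'
      · exact h'
      · rw [h', ih, Set.inter_self]
  · refine ⟨P.activeSet (R.x N) ∩ A, eventually_atTop.2 ⟨N + 1, fun k hk => ?_⟩⟩
    have hcap : ∀ k, N ≤ k → P.activeSet (R.x (k + 1)) = P.activeSet (R.x k) ∩ A :=
      fun k hk => (hstep k hk).resolve_left fun h' => hhit ⟨k + 1, by omega, h'⟩
    induction k, hk using Nat.le_induction with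
    | base => exact hcap N le_rfl
    | succ k hk ih => rw [hcap k (by omega), ih, Set.inter_assoc, Set.inter_self]

end Run

end PGiPN

end

theorem lemma5p2 {n p : ℕ} (P : PGiPN.Problem n p) (c : PGiPN.Params) (R : PGiPN.Run P c)
    (O : Set (PGiPN.Vec n)) (hO : IsOpen O) (hΓO : R.accPts ⊆ O)
    (hLip : LocallyLipschitzOn O (PGiPN.hess P.f)) :
    -- the supports stabilize, so `Π_* = Π(x^{kbar+1})` is well defined
    (∃ kbar, R.SupportsStableAfter kbar) ∧
    ∀ kbar, R.SupportsStableAfter kbar →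
      (∀ xs ∈ R.accPts, (0 : PGiPN.Vec n) ∈ ({∇ P.f xs} : Set (PGiPN.Vec n)) +
        intrinsicInterior ℝ (PGiPN.normalCone (P.PiSet (R.x (kbar + 1))) xs)) →
      ∃ (A : Set (Fin (n + n))) (N : ProperCone ℝ (PGiPN.Vec n)),
        ∀ᶠ k in atTop, P.activeSet (R.x k) = A ∧
          PGiPN.normalCone (P.PiSet (R.x (kbar + 1))) (R.x k) = (N : Set (PGiPN.Vec n)) := by
  refine ⟨R.exists_supportsStableAfter, fun kbar h hri => ?_⟩
  obtain ⟨A, hA⟩ := R.exists_activeSet_x_eq h hri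
  obtain ⟨K, hK⟩ := eventually_atTop.1 (hA.and (eventually_gt_atTop kbar))
  have hmem : ∀ k, K ≤ k → R.x k ∈ P.PiSet (R.x (kbar + 1)) := fun k hk => by
    rw [← h.PiSet_eq (hK k hk).2]
    exact P.self_mem_PiSet (R.x_mem_box k)
  obtain ⟨N, hN⟩ := PGiPN.exists_properCone_eq_normalCone (hmem K le_rfl)
  refine ⟨A, N, eventually_atTop.2 ⟨K, fun k hk => ⟨(hK k hk).1, ?_⟩⟩⟩
  have hAk : P.activeSet (R.x k) = P.activeSet (R.x K) :=
    (hK k hk).1.trans (hK K le_rfl).1.symm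
  rw [← hN]
  exact (P.normalCone_PiSet_mono (hmem k hk) (hmem K le_rfl) hAk.le).antisymm
    (P.normalCone_PiSet_mono (hmem K le_rfl) (hmem k hk) hAk.ge)
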